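/- Let $\mathcal W$ be a real separable Banach space with norm $\|\cdot\|_{\mathcal W}$ and let $\mu$ be a centered non-degenerate Gaussian measure on $\mathcal W$, that is, a Borel probability measure such that every non-zero $\ell\in\mathcal W^*$ is under $\mu$ a Gaussian random variable with mean zero and strictly positive variance. Let $\mathcal H_\mu$ be the Cameron–Martin space of $\mu$, i.e. the Hilbert space, continuously embedded in $\mathcal W$, obtained by completing the space of all $h\in\mathcal W$ for which there is $h^*\in\mathcal W^*$ with $\int h^*\ell\,d\mu=\ell(h)$ for all $\ell\in\mathcal W^*$, under the inner product $\langle h,k\rangle_{\mathcal H_\mu}=\int h^*k^*\,d\mu$. A $\mathcal W$-valued Brownian motion (associated with $\mu$) started at $x\in\mathcal W$ is a $\mathcal W$-valued process $B=(B(t))_{t\ge 0}$ with continuous paths and $B(0)=x$, with independent increments, such that for $0\le s\le t$ the increment $B(t)-B(s)$ has the law of $\sqrt{t-s}\,Z$ where $Z$ has law $\mu$. Suppose there is a sequence $(e_k)_{k\ge1}$ of elements of $\mathcal H_\mu\subseteq\mathcal W$ which is an orthonormal basis of $\mathcal H_\mu$ and also a Schauder basis of $\mathcal W$ (every $x\in\mathcal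 W$ has a unique expansion $x=\sum_{k=1}^\infty\alpha_k e_k$, $\alpha_k\in\mathbb R$, as a $\|\cdot\|_{\mathcal W}$-limit of partial sums). Then for any two starting points $x,y\in\mathcal W$ there exist, on a common probability space, $\mathcal W$-valued Brownian motions $B$ and $\widetilde B$ associated with $\mu$, started at $x$ and $y$ respectively, such that $$\mathbb P\bigl[\,\|B(t)-\widetilde B(t)\|_{\mathcal W}\to 0\text{ as }t\to\infty\,\bigr]=1 .$$ -/

import Mathlib

open MeasureTheory ProbabilityTheory Filter Topology
open scoped NNReal

universe u

/-- `e 0, e 1, …` is a Schauder basis of `W`: every `x : W` has a unique expansion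
`x = ∑ₖ αₖ eₖ`, convergence being that of the ordered partial sums in the norm of `W`. -/
def IsSchauderBasisSeq {W : Type*} [NormedAddCommGroup W] [NormedSpace ℝ W] (e : ℕ → W) : Prop :=
  ∀ x : W, ∃! α : ℕ → ℝ,
    Tendsto (fun n : ℕ => ∑ k ∈ Finset.range n, α k • e k) atTop (𝓝 x)

/-- A centered non-degenerate Gaussian measure on `W`: for every `ℓ` in the dual, the image of `μ`
under `ℓ` is Gaussian on `ℝ`, it has mean zero, and it has positive variance when `ℓ ≠ 0`. -/
structure IsCenteredNondegGaussian {W : Type*} [NormedAddCommGroup W] [NormedSpace ℝ W]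
    [MeasurableSpace W] (μ : Measure W) : Prop where
  gaussian : IsGaussian μ
  centered : ∀ ℓ : StrongDual ℝ W, ∫ w, ℓ w ∂μ = 0
  nondegenerate : ∀ ℓ : StrongDual ℝ W, ℓ ≠ 0 → 0 < ∫ w, ℓ w ^ 2 ∂μ

/-- The Cameron–Martin space of `μ` as a Hilbert space: the completion of the dual of `W` under the
covariance inner product `(ℓ₁, ℓ₂) ↦ ∫ ℓ₁ ℓ₂ ∂μ`, realised as the closure of the (classes of the)
continuous linear functionals in `L²(μ)`.  Its elements are identified with elements of `W`
by `cameronMartinIncl`. -/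
noncomputable abbrev cameronMartin {W : Type*} [NormedAddCommGroup W] [NormedSpace ℝ W]
    [MeasurableSpace W] [BorelSpace W] (μ : Measure W) : Submodule ℝ (Lp ℝ 2 μ) :=
  (LinearMap.range (StrongDual.toLp (𝕜 := ℝ) μ 2).toLinearMap).topologicalClosure

/-- The embedding of the Cameron–Martin space in `W`, sending `φ` to the barycentre
`∫ φ(w) w μ(dw)` (a Bochner integral). -/
noncomputable def cameronMartinIncl {W : Type*} [NormedAddCommGroup W] [NormedSpace ℝ W]
    [MeasurableSpace W] [BorelSpace W] (μ : Measure W) (φ : cameronMartin μ) : W :=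
  ∫ w, (φ : Lp ℝ 2 μ) w • w ∂μ

/-- For Gaussian `μ` the integral defining the embedding converges. -/
theorem integrable_cameronMartinIncl {W : Type*} [NormedAddCommGroup W] [NormedSpace ℝ W]
    [CompleteSpace W] [TopologicalSpace.SeparableSpace W] [MeasurableSpace W] [BorelSpace W]
    (μ : Measure W) [IsGaussian μ] (φ : cameronMartin μ) :
    Integrable (fun w => (φ : Lp ℝ 2 μ) w • w) μ := by
  have := UniformSpace.secondCountable_of_separable W
  exact memLp_one_iff_integrable.1
    ((IsGaussian.memLp_two_id (μ := μ)).smul (Lp.memLp (φ : Lp ℝ 2 μ)))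

/-- Evaluating a functional `ℓ` on the image of `φ` is the covariance of `φ` and `ℓ`.  For `φ` the
class of a functional `h*` this says that its image is the vector `h` with
`∫ h* ℓ ∂μ = ℓ h` for all `ℓ`. -/
theorem apply_cameronMartinIncl {W : Type*} [NormedAddCommGroup W] [NormedSpace ℝ W]
    [CompleteSpace W] [TopologicalSpace.SeparableSpace W] [MeasurableSpace W] [BorelSpace W]
    (μ : Measure W) [IsGaussian μ] (φ : cameronMartin μ) (ℓ : StrongDual ℝ W) :
    ℓ (cameronMartinIncl μ φ) = ∫ w, (φ : Lp ℝ 2 μ) w * ℓ w ∂μ := by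
  rw [cameronMartinIncl, ← ℓ.integral_comp_comm (integrable_cameronMartinIncl μ φ)]
  simp

/-- The sequence `e` in `W` is an orthonormal basis of the Cameron–Martin space of `μ`. -/
def IsCameronMartinBasis {W : Type*} [NormedAddCommGroup W] [NormedSpace ℝ W]
    [MeasurableSpace W] [BorelSpace W] (μ : Measure W) (e : ℕ → W) : Prop :=
  ∃ b : HilbertBasis ℕ ℝ (cameronMartin μ), ∀ k, cameronMartinIncl μ (b k) = e k

/-- `B` is a `W`-valued Brownian motion, associated with the centered Gaussian measure `μ` and
started at `x`: a continuous process with `B 0 = x`, with independent increments, and such that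
`B t - B s` has the law of `√(t - s) • Z` with `Z` of law `μ`.  For `x = 0` the law of `B 1`
is `μ`. -/
structure IsBanachBrownianMotion {W : Type*} [NormedAddCommGroup W] [NormedSpace ℝ W]
    [MeasurableSpace W] {Ω : Type*} [MeasurableSpace Ω]
    (μ : Measure W) (x : W) (B : ℝ≥0 → Ω → W) (P : Measure Ω) : Prop where
  measurable : ∀ t, Measurable (B t)
  start : ∀ ω, B 0 ω = x
  continuous_paths : ∀ ω, Continuous (fun t => B t ω)
  indep_increments : HasIndepIncrements B P
  law_increments : ∀ s t : ℝ≥0, s ≤ t →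
    P.map (fun ω => B t ω - B s ω) = μ.map (fun w => Real.sqrt ((t : ℝ) - (s : ℝ)) • w)

/-!
Two Brownian motions associated with a Gaussian measure `μ` can be coupled so that they approach each
other, whatever their starting points `x` and `y`.

Let `ℓ` be a functional and `v` its covariance vector, `∫ m ℓ ∂μ = m v` for all `m`.  The reflection
`w ↦ w - 2 (ℓ w / ℓ v) v` preserves `μ`.  Reflecting a Brownian motion `B` in the hyperplane on which
`ℓ` is half-way between its values at `x` and `x - v`, until that hyperplane is crossed, therefore
gives a Brownian motion `B'` from `x - v` (`IsBrownianFrom.reflect`).  The difference `B - B'` is a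
real process times `v`; it vanishes after the crossing, which is almost surely finite, and its
supremum exceeds `3 r⁻² ‖v‖` with probability at most `2 r` (`IsBrownianFrom.exists_coupling`).
Both bounds come from the reflection principle itself.

The covariance vectors are dense in `W` (`exists_covariance_vector_near`), so `x - y` is a series of
covariance vectors `vⱼ` whose norms decay as fast as desired.  Successive couplings yield Brownian
motions `B = C 0, C 1, …` on one probability space, where `C j` starts at `x - v₀ - … - vⱼ₋₁`.  By
Borel–Cantelli the sequence converges uniformly in time, almost surely, to a Brownian motion `B'`
from `y`, and since each `C j` eventually coincides with `B`, the distance `‖B t - B' t‖` tends to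
`0` (`IsBrownianFrom.exists_asymptotic_coupling`).  Neither independence of the successive couplings
nor orthogonality of the `vⱼ` is involved.

Brownian motion itself is built by midpoint displacement (`exists_isBrownianFrom`).  Throughout, the
law of a process is handled through the characteristic functional of its increments, a description
that passes to pointwise limits: of random walks on dyadic grids (`HasBrownianIncrements.of_walks`)
and of the motions `C j` (`HasBrownianIncrements.of_tendsto`).
-/

set_option linter.unusedSectionVars false

/-! ### Brownian increments through their characteristic functional -/

/-- The covariance quadratic form of `μ` on the dual, `ℓ ↦ ∫ ℓ² ∂μ`. -/
noncomputable def covForm {W : Type*} [NormedAddCommGroup W] [NormedSpace ℝ W]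
    [MeasurableSpace W] (μ : Measure W) (ℓ : StrongDual ℝ W) : ℝ := ∫ w, ℓ w ^ 2 ∂μ

/-- The increments of `B` along every monotone sequence of times have the joint characteristic
functional of independent Gaussian vectors with covariance forms `(t (k + 1) - t k) • covForm μ`. -/
def HasBrownianIncrements {W : Type*} [NormedAddCommGroup W] [NormedSpace ℝ W]
    [MeasurableSpace W] {Ω : Type*} [MeasurableSpace Ω]
    (μ : Measure W) (B : ℝ≥0 → Ω → W) (P : Measure Ω) : Prop :=
  ∀ (n : ℕ) (t : ℕ → ℝ≥0), Monotone t → ∀ L : ℕ → StrongDual ℝ W,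
    ∫ ω, Complex.exp ((∑ k ∈ Finset.range n, L k (B (t (k + 1)) ω - B (t k) ω) : ℝ) * Complex.I) ∂P
      = (Real.exp (-(∑ k ∈ Finset.range n,
          ((t (k + 1) : ℝ) - t k) * covForm μ (L k)) / 2) : ℝ)

/-- The steps of the random walk `S` have the joint characteristic functional of independent
Gaussian vectors with covariance form `δ • covForm μ`. -/
def IsGaussianWalk {W : Type*} [NormedAddCommGroup W] [NormedSpace ℝ W]
    [MeasurableSpace W] {Ω : Type*} [MeasurableSpace Ω]
    (μ : Measure W) (δ : ℝ) (S : ℕ → Ω → W) (P : Measure Ω) : Prop :=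
  ∀ (N : ℕ) (L : ℕ → StrongDual ℝ W),
    ∫ ω, Complex.exp ((∑ k ∈ Finset.range N, L k (S (k + 1) ω - S k ω) : ℝ) * Complex.I) ∂P
      = (Real.exp (-(δ * ∑ k ∈ Finset.range N, covForm μ (L k)) / 2) : ℝ)

/-- A continuous process started at `x` with Brownian increments in the sense of characteristic
functionals.  It is a Brownian motion by `IsBrownianFrom.isBanachBrownianMotion`; this form is
preserved by pointwise limits. -/
structure IsBrownianFrom {W : Type*} [NormedAddCommGroup W] [NormedSpace ℝ W]
    [MeasurableSpace W] {Ω : Type*} [MeasurableSpace Ω]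
    (μ : Measure W) (x : W) (B : ℝ≥0 → Ω → W) (P : Measure Ω) : Prop where
  measurable : ∀ t, Measurable (B t)
  start : ∀ ω, B 0 ω = x
  continuous_paths : ∀ ω, Continuous (fun t => B t ω)
  increments : HasBrownianIncrements μ B P

section CharFun

variable {W : Type*} [NormedAddCommGroup W] [NormedSpace ℝ W] [MeasurableSpace W] [BorelSpace W]
  {Ω : Type*} [MeasurableSpace Ω] {P : Measure Ω} {μ : Measure W}

theorem IsCenteredNondegGaussian.charFunDual_eq (hμ : IsCenteredNondegGaussian μ)
    (ℓ : StrongDual ℝ W) : charFunDual μ ℓ = (Real.exp (-covForm μ ℓ / 2) : ℝ) := by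
  have := hμ.gaussian
  rw [IsGaussian.charFunDual_eq, variance_of_integral_eq_zero (by fun_prop) (hμ.centered ℓ)]
  have h0 : (∫ w, ((ℓ w : ℝ) : ℂ) ∂μ) = 0 := by
    rw [integral_complex_ofReal, hμ.centered ℓ]; simp
  rw [h0, covForm]
  push_cast
  congr 1
  ring

theorem integrable_dual_mul [IsGaussian μ] (ℓ m : StrongDual ℝ W) :
    Integrable (fun w => ℓ w * m w) μ :=
  (IsGaussian.memLp_dual μ ℓ 2 (by simp)).integrable_mul (IsGaussian.memLp_dual μ m 2 (by simp))

theorem covForm_smul (c : ℝ) (ℓ : StrongDual ℝ W) : covForm μ (c • ℓ) = c ^ 2 * covForm μ ℓ := by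
  simp only [covForm, ← integral_const_mul]
  congr 1; ext w; simp [mul_pow]

theorem covForm_add_smul [IsGaussian μ] (ℓ m : StrongDual ℝ W) (c : ℝ) :
    covForm μ (ℓ + c • m) = covForm μ ℓ + 2 * c * ∫ w, ℓ w * m w ∂μ + c ^ 2 * covForm μ m := by
  simp only [covForm, ← integral_const_mul]
  have h1 := integrable_dual_mul (μ := μ) ℓ ℓ
  have h2 := integrable_dual_mul (μ := μ) ℓ m
  have h3 := integrable_dual_mul (μ := μ) m m
  simp only [← pow_two] at h1 h3
  have h4 : Integrable (fun w => ℓ w ^ 2 + 2 * c * (ℓ w * m w)) μ := h1.add (h2.const_mul _)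
  rw [← integral_add h1 (h2.const_mul _), ← integral_add h4 (h3.const_mul _)]
  congr 1; ext w; simp; ring

theorem norm_cexp_mul_I_le (r : ℝ) : ‖Complex.exp ((r : ℂ) * Complex.I)‖ ≤ 1 := by
  rw [Complex.norm_exp_ofReal_mul_I]

theorem HasBrownianIncrements.charFunDual_sub (hB : HasBrownianIncrements μ B P)
    (hm : ∀ t, Measurable (B t)) [SecondCountableTopology W] {s t : ℝ≥0} (hst : s ≤ t)
    (ℓ : StrongDual ℝ W) :
    charFunDual (P.map (fun ω => B t ω - B s ω)) ℓ
      = (Real.exp (-(((t : ℝ) - s) * covForm μ ℓ) / 2) : ℝ) := by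
  have hts : Measurable (fun ω => B t ω - B s ω) := (hm t).sub (hm s)
  rw [charFunDual_apply, integral_map hts.aemeasurable (by fun_prop)]
  have := hB 1 (fun k => if k = 0 then s else t)
    (monotone_nat_of_le_succ fun k => by by_cases hk : k = 0 <;> simp [hk, hst]) (fun _ => ℓ)
  simpa using this

theorem HasBrownianIncrements.iIndepFun [CompleteSpace W] [SecondCountableTopology W]
    [IsProbabilityMeasure P] {B : ℝ≥0 → Ω → W}
    (hB : HasBrownianIncrements μ B P) (hm : ∀ t, Measurable (B t)) {n : ℕ} {t : ℕ → ℝ≥0}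
    (ht : Monotone t) :
    iIndepFun (fun (i : Fin n) ω => B (t (i + 1)) ω - B (t i) ω) P := by
  have hX : ∀ i : Fin n, Measurable (fun ω => B (t (i + 1)) ω - B (t i) ω) :=
    fun i => (hm _).sub (hm _)
  rw [iIndepFun_iff_charFunDual_pi fun i => (hX i).aemeasurable]
  intro L
  let L' : ℕ → StrongDual ℝ W := fun k =>
    if hk : k < n then L ∘SL ContinuousLinearMap.single ℝ (fun _ : Fin n => W) ⟨k, hk⟩ else 0
  have hL' : ∀ i : Fin n, L' i = L ∘SL ContinuousLinearMap.single ℝ (fun _ : Fin n => W) i :=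
    fun i => by simp [L']
  have h1 := hB n t ht L'
  rw [charFunDual_apply, integral_map (measurable_pi_iff.2 hX).aemeasurable (by fun_prop)]
  simp only [← hL']
  have h2 : ∀ ω, L (fun i : Fin n => B (t (i + 1)) ω - B (t i) ω)
      = ∑ k ∈ Finset.range n, L' k (B (t (k + 1)) ω - B (t k) ω) := by
    intro ω
    rw [Finset.sum_range, ← L.sum_comp_single]
    simp only [hL']
  simp only [h2, h1]
  rw [Finset.prod_congr rfl fun (i : Fin n) _ =>
    hB.charFunDual_sub hm (ht (Nat.le_succ (i : ℕ))) (L' i)]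
  rw [← Complex.ofReal_prod, ← Real.exp_sum, Finset.sum_range, ← Finset.sum_div,
    Finset.sum_neg_distrib]

/-- Characteristic functionals determine the joint laws of finitely many increments. -/
theorem IsBrownianFrom.isBanachBrownianMotion [CompleteSpace W] [SecondCountableTopology W]
    [IsProbabilityMeasure P] (hμ : IsCenteredNondegGaussian μ) {x : W} {B : ℝ≥0 → Ω → W}
    (hB : IsBrownianFrom μ x B P) : IsBanachBrownianMotion μ x B P where
  measurable := hB.measurable
  start := hB.start
  continuous_paths := hB.continuous_paths
  indep_increments := by
    intro n t ht
    let t' : ℕ → ℝ≥0 := fun k => t ⟨min n k, by omega⟩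
    have ht' : Monotone t' := fun a b hab => ht (by simp only [Fin.mk_le_mk]; omega)
    convert hB.increments.iIndepFun hB.measurable (n := n) ht' using 3 with i ω
    have h1 : min n ((i : ℕ) + 1) = i + 1 := by omega
    have h2 : min n (i : ℕ) = i := by omega
    simp only [t', h1, h2]
    rfl
  law_increments := by
    intro s t hst
    have := hμ.gaussian
    have hm : Measurable (fun ω => B t ω - B s ω) := (hB.measurable t).sub (hB.measurable s)
    have : IsProbabilityMeasure (P.map (fun ω => B t ω - B s ω)) :=
      Measure.isProbabilityMeasure_map hm.aemeasurable
    have : IsProbabilityMeasure (μ.map (fun w => Real.sqrt ((t : ℝ) - (s : ℝ)) • w)) :=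
      Measure.isProbabilityMeasure_map (by fun_prop)
    apply Measure.ext_of_charFunDual
    ext ℓ
    rw [hB.increments.charFunDual_sub hB.measurable hst, charFunDual_apply,
      integral_map (by fun_prop) (by fun_prop)]
    have h0 : (0 : ℝ) ≤ (t : ℝ) - s := sub_nonneg.2 (by exact_mod_cast hst)
    have h := hμ.charFunDual_eq (Real.sqrt ((t : ℝ) - s) • ℓ)
    rw [covForm_smul, Real.sq_sqrt h0, charFunDual_apply] at h
    rw [← h]
    simp

end CharFun

section Limit

variable {W : Type*} [NormedAddCommGroup W] [NormedSpace ℝ W] [MeasurableSpace W] [BorelSpace W]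
  [SecondCountableTopology W]
  {Ω : Type*} [MeasurableSpace Ω] {P : Measure Ω} {μ : Measure W}

/-- Joint characteristic functionals of increments pass to almost sure limits. -/
theorem tendsto_integral_cexp_increments [IsFiniteMeasure P] {B : ℝ≥0 → Ω → W}
    {C : ℕ → ℝ≥0 → Ω → W} (hC : ∀ m t, Measurable (C m t))
    (h : ∀ t, ∀ᵐ ω ∂P, Tendsto (fun m => C m t ω) atTop (𝓝 (B t ω)))
    (n : ℕ) (t : ℕ → ℝ≥0) (L : ℕ → StrongDual ℝ W) :
    Tendsto (fun m => ∫ ω, Complex.exp ((∑ k ∈ Finset.range n,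
        L k (C m (t (k + 1)) ω - C m (t k) ω) : ℝ) * Complex.I) ∂P) atTop
      (𝓝 (∫ ω, Complex.exp ((∑ k ∈ Finset.range n,
        L k (B (t (k + 1)) ω - B (t k) ω) : ℝ) * Complex.I) ∂P)) := by
  refine tendsto_integral_of_dominated_convergence (fun _ => 1) (fun m => ?_)
    (integrable_const _) (fun m => ae_of_all _ fun ω => norm_cexp_mul_I_le _) ?_
  · refine Measurable.aestronglyMeasurable ?_
    have : Measurable fun ω => (∑ k ∈ Finset.range n,
        L k (C m (t (k + 1)) ω - C m (t k) ω) : ℝ) :=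
      Finset.measurable_sum _ fun k _ => (L k).measurable.comp ((hC _ _).sub (hC _ _))
    fun_prop
  · filter_upwards [ae_all_iff.2 fun k => h (t k)] with ω hω
    have : Tendsto (fun m => (∑ k ∈ Finset.range n,
        L k (C m (t (k + 1)) ω - C m (t k) ω) : ℝ)) atTop
        (𝓝 (∑ k ∈ Finset.range n, L k (B (t (k + 1)) ω - B (t k) ω))) :=
      tendsto_finsetSum _ fun k _ =>
        ((L k).continuous.tendsto _).comp ((hω (k + 1)).sub (hω k))
    exact (Complex.continuous_exp.tendsto _).comp
      (((Complex.continuous_ofReal.tendsto _).comp this).mul_const _)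

theorem HasBrownianIncrements.of_tendsto [IsFiniteMeasure P] {B : ℝ≥0 → Ω → W}
    {C : ℕ → ℝ≥0 → Ω → W} (hC : ∀ m t, Measurable (C m t))
    (hCB : ∀ m, HasBrownianIncrements μ (C m) P)
    (h : ∀ t, ∀ᵐ ω ∂P, Tendsto (fun m => C m t ω) atTop (𝓝 (B t ω))) :
    HasBrownianIncrements μ B P := by
  intro n t ht L
  refine tendsto_nhds_unique (tendsto_integral_cexp_increments hC h n t L) ?_
  simp only [hCB _ n t ht L]
  exact tendsto_const_nhds

/-- The characteristic functional of a Gaussian walk along a monotone sequence of indices. -/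
theorem IsGaussianWalk.integral_cexp {δ : ℝ} {S : ℕ → Ω → W} (hS : IsGaussianWalk μ δ S P)
    (n : ℕ) {K : ℕ → ℕ} (hK : Monotone K) (L : ℕ → StrongDual ℝ W) :
    ∫ ω, Complex.exp ((∑ i ∈ Finset.range n, L i (S (K (i + 1)) ω - S (K i) ω) : ℝ)
        * Complex.I) ∂P
      = (Real.exp (-(∑ i ∈ Finset.range n,
          (δ * ((K (i + 1) : ℝ) - K i)) * covForm μ (L i)) / 2) : ℝ) := by
  -- the functional attached to a step is the one of the block `[K i, K (i + 1))` containing it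
  have key : ∀ n : ℕ, ∃ M : ℕ → StrongDual ℝ W,
      (∀ ω, ∑ k ∈ Finset.range (K n), M k (S (k + 1) ω - S k ω)
        = ∑ i ∈ Finset.range n, L i (S (K (i + 1)) ω - S (K i) ω)) ∧
      ∑ k ∈ Finset.range (K n), covForm μ (M k)
        = ∑ i ∈ Finset.range n, ((K (i + 1) : ℝ) - K i) * covForm μ (L i) := by
    intro n
    induction n with
    | zero => exact ⟨fun _ => 0, by simp, by simp [covForm]⟩
    | succ n ih =>
      obtain ⟨M, h1, h2⟩ := ih
      have hle := hK (Nat.le_succ n)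
      have e1 : ∀ k ∈ Finset.range (K n), (if k < K n then M k else L n) = M k :=
        fun k hk => if_pos (Finset.mem_range.1 hk)
      have e2 : ∀ k ∈ Finset.Ico (K n) (K (n + 1)), (if k < K n then M k else L n) = L n :=
        fun k hk => if_neg (not_lt.2 (Finset.mem_Ico.1 hk).1)
      refine ⟨fun k => if k < K n then M k else L n, fun ω => ?_, ?_⟩
      · rw [Finset.sum_range_succ, ← h1 ω, ← Finset.sum_range_add_sum_Ico _ hle]
        congr 1
        · exact Finset.sum_congr rfl fun k hk => by simp only [e1 k hk]
        · rw [← Finset.sum_Ico_sub (fun k => S k ω) hle, map_sum]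
          exact Finset.sum_congr rfl fun k hk => by simp only [e2 k hk]
      · rw [Finset.sum_range_succ, ← h2, ← Finset.sum_range_add_sum_Ico _ hle]
        congr 1
        · exact Finset.sum_congr rfl fun k hk => by simp only [e1 k hk]
        · have : ((K (n + 1) : ℝ) - K n) * covForm μ (L n)
              = ∑ k ∈ Finset.Ico (K n) (K (n + 1)), covForm μ (L n) := by simp [Nat.cast_sub hle]
          rw [this]
          exact Finset.sum_congr rfl fun k hk => by simp only [e2 k hk]
  obtain ⟨M, h1, h2⟩ := key n
  have := hS (K n) M
  simp only [h1, h2] at this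
  rw [this, Finset.mul_sum]
  simp only [mul_assoc]

/-- The index of the last point of the dyadic grid of mesh `2⁻ᵐ` before `t`. -/
noncomputable def dyadicIndex (m : ℕ) (t : ℝ≥0) : ℕ := ⌊(t : ℝ) * 2 ^ m⌋₊

theorem dyadicIndex_mono (m : ℕ) : Monotone (dyadicIndex m) := fun s t h =>
  Nat.floor_mono (by gcongr)

theorem dyadicIndex_le (m : ℕ) (t : ℝ≥0) : (dyadicIndex m t : ℝ≥0) / 2 ^ m ≤ t := by
  rw [div_le_iff₀ (by positivity), ← NNReal.coe_le_coe]
  push_cast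
  exact Nat.floor_le (by positivity)

theorem tendsto_dyadicIndex (t : ℝ≥0) :
    Tendsto (fun m => (dyadicIndex m t : ℝ≥0) / 2 ^ m) atTop (𝓝 t) := by
  rw [← NNReal.tendsto_coe]
  have := (tendsto_nat_floor_mul_div_atTop t.coe_nonneg).comp
    (tendsto_pow_atTop_atTop_of_one_lt (by norm_num : (1 : ℝ) < 2))
  refine this.congr fun m => ?_
  simp [dyadicIndex]

/-- If walks on finer and finer dyadic grids converge to `B`, then `B` has Brownian increments. -/
theorem HasBrownianIncrements.of_walks [IsFiniteMeasure P] {B : ℝ≥0 → Ω → W}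
    {S : ℕ → ℕ → Ω → W} (hm : ∀ m k, Measurable (S m k))
    (hS : ∀ m, IsGaussianWalk μ ((2 ^ m)⁻¹) (S m) P)
    (h : ∀ t, ∀ᵐ ω ∂P, Tendsto (fun m => S m (dyadicIndex m t) ω) atTop (𝓝 (B t ω))) :
    HasBrownianIncrements μ B P := by
  intro n t ht L
  refine tendsto_nhds_unique (tendsto_integral_cexp_increments
    (C := fun m t => S m (dyadicIndex m t)) (fun m t => hm _ _) h n t L) ?_
  refine Tendsto.congr
    (fun m => ((hS m).integral_cexp n ((dyadicIndex_mono m).comp ht) L).symm) ?_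
  refine (Complex.continuous_ofReal.tendsto _).comp ((Real.continuous_exp.tendsto _).comp
    (Tendsto.div_const (Tendsto.neg (tendsto_finsetSum _ fun k _ => Tendsto.mul_const _ ?_)) _))
  have h1 : ∀ k, Tendsto (fun m => (dyadicIndex m (t k) : ℝ) / 2 ^ m) atTop (𝓝 (t k : ℝ)) :=
    fun k => by simpa using (NNReal.tendsto_coe.2 (tendsto_dyadicIndex (t k)))
  refine ((h1 (k + 1)).sub (h1 k)).congr fun m => ?_
  simp only [Function.comp]
  ring

theorem HasBrownianIncrements.isGaussianWalk {B : ℝ≥0 → Ω → W}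
    (hB : HasBrownianIncrements μ B P) (m : ℕ) :
    IsGaussianWalk μ ((2 ^ m)⁻¹) (fun k => B ((k : ℝ≥0) / 2 ^ m)) P := by
  intro N L
  have := hB N (fun k => (k : ℝ≥0) / 2 ^ m) (fun a b h => by dsimp only; gcongr) L
  rw [this, Finset.mul_sum]
  congr 4
  refine Finset.sum_congr rfl fun k _ => ?_
  push_cast
  ring

end Limit

/-! ### Existence of Brownian motion: midpoint displacement -/

section Regularisation

variable {W : Type*} [NormedAddCommGroup W] [NormedSpace ℝ W] [MeasurableSpace W] [BorelSpace W]
  {Ω : Type*} [MeasurableSpace Ω] {P : Measure Ω}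

/-- If almost every sample sequence of the processes `C m` converges to a continuous path, the limit
has a version all of whose paths are continuous. -/
theorem exists_continuous_limit (x : W) {C : ℕ → ℝ≥0 → Ω → W} (hC : ∀ m t, Measurable (C m t))
    (h : ∀ᵐ ω ∂P, ∃ p : ℝ≥0 → W, p 0 = x ∧ Continuous p ∧
      ∀ t, Tendsto (fun m => C m t ω) atTop (𝓝 (p t))) :
    ∃ B : ℝ≥0 → Ω → W, (∀ t, Measurable (B t)) ∧ (∀ ω, B 0 ω = x) ∧
      (∀ ω, Continuous fun t => B t ω) ∧
      ∀ᵐ ω ∂P, ∀ t, Tendsto (fun m => C m t ω) atTop (𝓝 (B t ω)) := by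
  classical
  obtain ⟨N, hN, hNm, hN0⟩ := exists_measurable_superset_of_null (ae_iff.1 h)
  have hN' : ∀ ω, ω ∉ N → ∃ p : ℝ≥0 → W, p 0 = x ∧ Continuous p ∧
      ∀ t, Tendsto (fun m => C m t ω) atTop (𝓝 (p t)) := by
    intro ω hω
    by_contra hne
    exact hω (hN hne)
  choose! p hp0 hpc hpt using hN'
  refine ⟨fun t ω => if ω ∈ N then x else p ω t, fun t => ?_, fun ω => ?_, fun ω => ?_, ?_⟩
  · refine measurable_of_tendsto_metrizable
      (f := fun m ω => if ω ∈ N then x else C m t ω)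
      (fun m => Measurable.ite hNm measurable_const (hC m t)) (tendsto_pi_nhds.2 fun ω => ?_)
    by_cases hω : ω ∈ N
    · simp [hω]
    · simpa [hω] using hpt ω hω t
  · by_cases hω : ω ∈ N
    · simp [hω]
    · simpa [hω] using hp0 ω hω
  · by_cases hω : ω ∈ N
    · simpa [hω] using continuous_const
    · simpa [hω] using hpc ω hω
  · have : ∀ᵐ ω ∂P, ω ∉ N := measure_eq_zero_iff_ae_notMem.1 hN0
    filter_upwards [this] with ω hω t
    simpa [hω] using hpt ω hω t

/-- Consistent dyadic values whose steps decay geometrically, uniformly on bounded time intervals,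
are the dyadic values of a continuous path. -/
theorem exists_continuous_path_of_dyadic [CompleteSpace W] {V : ℕ → ℕ → W} {θ : ℝ}
    (hθ0 : 0 < θ) (hθ1 : θ < 1) (hV : ∀ m k, V (m + 1) (2 * k) = V m k)
    (hs : ∀ N : ℕ, ∀ᶠ m in atTop, ∀ k < N * 2 ^ m, ‖V m (k + 1) - V m k‖ ≤ θ ^ m) :
    ∃ p : ℝ≥0 → W, p 0 = V 0 0 ∧ Continuous p ∧
      ∀ t, Tendsto (fun m => V m (dyadicIndex m t)) atTop (𝓝 (p t)) := by
  have hidx : ∀ (N m : ℕ) (t : ℝ≥0), t < N → dyadicIndex m t < N * 2 ^ m := by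
    intro N m t ht
    rw [dyadicIndex, Nat.floor_lt (by positivity)]
    push_cast
    have : (t : ℝ) < N := by exact_mod_cast ht
    gcongr
  -- one refinement moves the step function by at most one step of the finer walk
  have hstep : ∀ N : ℕ, ∃ m₀, ∀ m ≥ m₀, ∀ t : ℝ≥0, t < N →
      (∀ k < N * 2 ^ m, ‖V m (k + 1) - V m k‖ ≤ θ ^ m) ∧
      dist (V m (dyadicIndex m t)) (V (m + 1) (dyadicIndex (m + 1) t)) ≤ 1 * θ ^ m := by
    intro N
    obtain ⟨m₀, hm₀⟩ := eventually_atTop.1 (hs N)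
    refine ⟨m₀, fun m hm t ht => ⟨hm₀ m hm, ?_⟩⟩
    have h1 := hidx N m t ht
    have h2 := hm₀ (m + 1) (by omega) (2 * dyadicIndex m t) (by rw [pow_succ]; nlinarith)
    have h3 : dyadicIndex (m + 1) t / 2 = dyadicIndex m t := by
      have h : (t : ℝ) * 2 ^ m = t * 2 ^ (m + 1) / 2 := by ring
      rw [dyadicIndex, dyadicIndex, h, Nat.floor_div_ofNat]
    have h4 : θ ^ (m + 1) ≤ 1 * θ ^ m := by
      rw [one_mul]; exact pow_le_pow_of_le_one hθ0.le hθ1.le (Nat.le_succ m)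
    rcases Nat.mod_two_eq_zero_or_one (dyadicIndex (m + 1) t) with h5 | h5
    · have h6 : dyadicIndex (m + 1) t = 2 * dyadicIndex m t := by omega
      rw [h6, hV, dist_self]
      positivity
    · have h6 : dyadicIndex (m + 1) t = 2 * dyadicIndex m t + 1 := by omega
      rw [h6, ← hV, dist_comm, dist_eq_norm]
      exact h2.trans h4
  have hconv : ∀ t : ℝ≥0, ∃ y, Tendsto (fun m => V m (dyadicIndex m t)) atTop (𝓝 y) := by
    intro t
    obtain ⟨N, hN⟩ := exists_nat_gt t
    obtain ⟨m₀, hm₀⟩ := hstep N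
    have hc : CauchySeq fun m => V (m + m₀) (dyadicIndex (m + m₀) t) := by
      refine cauchySeq_of_le_geometric θ (1 * θ ^ m₀) hθ1 fun m => ?_
      have := (hm₀ (m + m₀) (by omega) t hN).2
      rw [show m + 1 + m₀ = m + m₀ + 1 by omega]
      refine this.trans (le_of_eq ?_)
      ring
    obtain ⟨y, hy⟩ := cauchySeq_tendsto_of_complete hc
    exact ⟨y, (tendsto_add_atTop_iff_nat m₀).1 hy⟩
  choose p hp using hconv
  refine ⟨p, ?_, ?_, hp⟩
  · have h0 : ∀ m, V m 0 = V 0 0 := by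
      intro m
      induction m with
      | zero => rfl
      | succ m ih => rw [← ih, ← hV m 0]
    refine tendsto_nhds_unique (hp 0) ?_
    simp [dyadicIndex, h0]
  · rw [Metric.continuous_iff']
    intro t₀ ε hε
    obtain ⟨N, hN⟩ := exists_nat_gt t₀
    obtain ⟨m₀, hm₀⟩ := hstep N
    have hlim : Tendsto (fun m : ℕ => θ ^ m + 2 * (θ ^ m / (1 - θ))) atTop (𝓝 0) := by
      have := tendsto_pow_atTop_nhds_zero_of_lt_one hθ0.le hθ1
      simpa using this.add ((this.div_const (1 - θ)).const_mul 2)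
    obtain ⟨m, hm1, hm2⟩ := ((hlim.eventually (gt_mem_nhds hε)).and (eventually_ge_atTop m₀)).exists
    have hclose : ∀ t : ℝ≥0, t < N → dist (V m (dyadicIndex m t)) (p t) ≤ θ ^ m / (1 - θ) := by
      intro t ht
      have := dist_le_of_le_geometric_of_tendsto₀ (f := fun j => V (j + m) (dyadicIndex (j + m) t))
        θ (θ ^ m) hθ1 (fun j => ?_) ((tendsto_add_atTop_iff_nat m).2 (hp t))
      · simpa using this
      · have := (hm₀ (j + m) (by omega) t ht).2
        rw [show j + 1 + m = j + m + 1 by omega]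
        refine this.trans (le_of_eq ?_)
        ring
    have hball : ∀ᶠ t : ℝ≥0 in 𝓝 t₀, dist t t₀ < (2 ^ m)⁻¹ :=
      Metric.ball_mem_nhds t₀ (by positivity)
    filter_upwards [hball, gt_mem_nhds hN] with t ht htN
    have hadj : ∀ s t : ℝ≥0, s ≤ t → s < N → dist s t < (2 ^ m)⁻¹ →
        dist (V m (dyadicIndex m s)) (V m (dyadicIndex m t)) ≤ θ ^ m := by
      intro s t hst hs hd
      have h1 := dyadicIndex_mono m hst
      have h2 : dyadicIndex m t ≤ dyadicIndex m s + 1 := by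
        have h3 : (t : ℝ) * 2 ^ m < s * 2 ^ m + 1 := by
          rw [NNReal.dist_eq, abs_sub_comm, abs_of_nonneg
            (sub_nonneg.2 (by exact_mod_cast hst))] at hd
          have := mul_lt_mul_of_pos_right hd (by positivity : (0 : ℝ) < 2 ^ m)
          rw [inv_mul_cancel₀ (by positivity)] at this
          linarith
        rw [dyadicIndex, dyadicIndex, ← Nat.floor_add_one (by positivity)]
        exact Nat.floor_mono h3.le
      rcases Nat.eq_or_lt_of_le h1 with h3 | h3
      · rw [h3, dist_self]; positivity
      · rw [show dyadicIndex m t = dyadicIndex m s + 1 by omega, dist_comm, dist_eq_norm]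
        exact (hm₀ m hm2 s hs).1 _ (hidx N m s hs)
    have hVV : dist (V m (dyadicIndex m t)) (V m (dyadicIndex m t₀)) ≤ θ ^ m := by
      rcases le_total t t₀ with h | h
      · exact hadj t t₀ h htN ht
      · rw [dist_comm]; exact hadj t₀ t h hN (by rwa [dist_comm])
    have h1 := hclose t htN
    have h2 := hclose t₀ hN
    rw [dist_comm] at h1
    calc dist (p t) (p t₀) ≤ _ := dist_triangle4 _ (V m (dyadicIndex m t))
          (V m (dyadicIndex m t₀)) _
      _ ≤ θ ^ m / (1 - θ) + θ ^ m + θ ^ m / (1 - θ) := by gcongr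
      _ < ε := by linarith

end Regularisation

section MidpointDisplacement

variable {W : Type u} [NormedAddCommGroup W] [NormedSpace ℝ W]

/-- Lévy's midpoint displacement: from independent vectors `z (m, k)` of law `μ`, the value at
time `k / 2 ^ m` of a Brownian motion started at `x`.  The vectors `z (0, k)` are the steps over
unit intervals; `z (m + 1, k)` displaces the midpoint of the `k`-th interval of length `2⁻ᵐ`. -/
noncomputable def midpointWalk (x : W) : ℕ → ℕ → (ℕ × ℕ → W) → W
  | 0, k, z => x + ∑ i ∈ Finset.range k, z (0, i)
  | m + 1, k, z =>
    if k % 2 = 0 then midpointWalk x m (k / 2) z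
    else (1 / 2 : ℝ) • (midpointWalk x m (k / 2) z + midpointWalk x m (k / 2 + 1) z)
      + (Real.sqrt ((2 ^ m)⁻¹) / 2) • z (m + 1, k / 2)

theorem midpointWalk_even (x : W) (m k : ℕ) (z : ℕ × ℕ → W) :
    midpointWalk x (m + 1) (2 * k) z = midpointWalk x m k z := by
  simp [midpointWalk]

theorem midpointWalk_odd (x : W) (m k : ℕ) (z : ℕ × ℕ → W) :
    midpointWalk x (m + 1) (2 * k + 1) z
      = (1 / 2 : ℝ) • (midpointWalk x m k z + midpointWalk x m (k + 1) z)
        + (Real.sqrt ((2 ^ m)⁻¹) / 2) • z (m + 1, k) := by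
  have h1 : (2 * k + 1) % 2 = 1 := by omega
  have h2 : (2 * k + 1) / 2 = k := by omega
  simp [midpointWalk, h1, h2]

variable [MeasurableSpace W] [BorelSpace W] [SecondCountableTopology W]

theorem measurable_midpointWalk (x : W) (m k : ℕ) : Measurable (midpointWalk x m k) := by
  induction m generalizing k with
  | zero =>
    show Measurable fun z : ℕ × ℕ → W => x + ∑ i ∈ Finset.range k, z (0, i)
    fun_prop
  | succ m ih =>
    by_cases hk : k % 2 = 0
    · have : midpointWalk x (m + 1) k = midpointWalk x m (k / 2) := by
        ext z; simp [midpointWalk, hk]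
      rw [this]; exact ih _
    · have : midpointWalk x (m + 1) k = fun z =>
          (1 / 2 : ℝ) • (midpointWalk x m (k / 2) z + midpointWalk x m (k / 2 + 1) z)
          + (Real.sqrt ((2 ^ m)⁻¹) / 2) • z (m + 1, k / 2) := by
        ext z; simp [midpointWalk, hk]
      rw [this]
      have h1 := ih (k / 2)
      have h2 := ih (k / 2 + 1)
      fun_prop

variable {μ : Measure W}

/-- The joint characteristic functional of finitely many independent vectors of law `μ`. -/
theorem integral_cexp_infinitePi {ι : Type} (hμ : IsCenteredNondegGaussian μ) (F : Finset ι)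
    (M : ι → StrongDual ℝ W) :
    ∫ z, Complex.exp ((∑ p ∈ F, M p (z p) : ℝ) * Complex.I) ∂(Measure.infinitePi fun _ : ι => μ)
      = (Real.exp (-(∑ p ∈ F, covForm μ (M p)) / 2) : ℝ) := by
  have := hμ.gaussian
  have hi := (iIndepFun_infinitePi (P := fun _ : ι => μ)
    (X := fun p w => Complex.exp ((M p w : ℝ) * Complex.I)) (fun p => by fun_prop)).precomp
    (g := fun p : F => (p : ι)) Subtype.val_injective
  have h := hi.integral_fun_prod_eq_prod_integral fun p => by
    refine Measurable.aestronglyMeasurable ?_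
    have : Measurable fun z : ι → W => z p := measurable_pi_apply _
    fun_prop
  have e1 : ∀ z : ι → W, Complex.exp ((∑ p ∈ F, M p (z p) : ℝ) * Complex.I)
      = ∏ p : F, Complex.exp ((M p (z p) : ℝ) * Complex.I) := by
    intro z
    rw [← Complex.exp_sum, ← Finset.sum_mul, ← Complex.ofReal_sum,
      Finset.sum_coe_sort F fun p => M p (z p)]
  have e2 : ∀ p : ι, ∫ z, Complex.exp ((M p (z p) : ℝ) * Complex.I)
      ∂(Measure.infinitePi fun _ : ι => μ) = (Real.exp (-covForm μ (M p) / 2) : ℝ) := by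
    intro p
    have hp := measurePreserving_eval_infinitePi (fun _ : ι => μ) p
    rw [← hμ.charFunDual_eq, charFunDual_apply]
    conv_rhs => rw [← hp.map_eq]
    rw [integral_map hp.measurable.aemeasurable (by fun_prop)]
  simp only [e1, h, e2]
  rw [← Complex.ofReal_prod, ← Real.exp_sum, Finset.sum_coe_sort F fun p => -covForm μ (M p) / 2,
    ← Finset.sum_div, Finset.sum_neg_distrib]

theorem sum_range_two_mul {M : Type*} [AddCommMonoid M] (g : ℕ → M) (n : ℕ) :
    ∑ k ∈ Finset.range (2 * n), g k = ∑ k ∈ Finset.range n, (g (2 * k) + g (2 * k + 1)) := by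
  induction n with
  | zero => simp
  | succ n ih => rw [show 2 * (n + 1) = 2 * n + 1 + 1 by ring, Finset.sum_range_succ,
      Finset.sum_range_succ, ih, Finset.sum_range_succ, add_assoc]

/-- Adding the indices `(m, 0), …, (m, R - 1)` of a new level `m` to a finite set of indices. -/
theorem sum_union_level {A M : Type*} [AddCommMonoid M] (g : A → ℕ × ℕ → M) (m R : ℕ)
    (F : Finset (ℕ × ℕ)) (hF : ∀ p ∈ F, p.1 ≠ m) (a : ℕ → A) (b : ℕ × ℕ → A) :
    ∑ p ∈ F ∪ (Finset.range R).image (fun k => (m, k)),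
        g (if p.1 = m then a p.2 else b p) p
      = ∑ k ∈ Finset.range R, g (a k) (m, k) + ∑ p ∈ F, g (b p) p := by
  rw [Finset.sum_union, add_comm, Finset.sum_image (by simp)]
  · congr 1
    · simp
    · exact Finset.sum_congr rfl fun p hp => by rw [if_neg (hF p hp)]
  · rw [Finset.disjoint_left]
    rintro p hp hp'
    obtain ⟨k, -, rfl⟩ := Finset.mem_image.1 hp'
    exact hF _ hp rfl

/-- The joint characteristic functional of the steps at level `m` and of any displacements of higher
levels.  The step from `m` to `m + 1` is the parallelogram law for `covForm μ`. -/
theorem integral_cexp_midpointWalk (hμ : IsCenteredNondegGaussian μ) (x : W) (m N : ℕ)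
    (L : ℕ → StrongDual ℝ W) (F : Finset (ℕ × ℕ)) (hF : ∀ p ∈ F, m < p.1)
    (M : ℕ × ℕ → StrongDual ℝ W) :
    ∫ z, Complex.exp ((∑ k ∈ Finset.range (N * 2 ^ m),
        L k (midpointWalk x m (k + 1) z - midpointWalk x m k z)
          + ∑ p ∈ F, M p (z p) : ℝ) * Complex.I) ∂(Measure.infinitePi fun _ : ℕ × ℕ => μ)
      = (Real.exp (-((2 ^ m)⁻¹ * ∑ k ∈ Finset.range (N * 2 ^ m), covForm μ (L k)
          + ∑ p ∈ F, covForm μ (M p)) / 2) : ℝ) := by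
  have := hμ.gaussian
  induction m generalizing L F M with
  | zero =>
    have h := integral_cexp_infinitePi hμ (F ∪ (Finset.range N).image (fun k => (0, k)))
      (fun p => if p.1 = 0 then L p.2 else M p)
    have e1 : ∀ z : ℕ × ℕ → W, _ := fun z => sum_union_level (fun ℓ p => ℓ (z p)) 0 N F
      (fun p hp => (hF p hp).ne') L M
    have e2 := sum_union_level (fun (ℓ : StrongDual ℝ W) _ => covForm μ ℓ) 0 N F
      (fun p hp => (hF p hp).ne') L M
    simp only [e1, e2] at h
    simpa [midpointWalk, Finset.sum_range_succ] using h
  | succ m ih =>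
    have h := ih (fun k => (1 / 2 : ℝ) • (L (2 * k) + (1 : ℝ) • L (2 * k + 1)))
      (F ∪ (Finset.range (N * 2 ^ m)).image (fun k => (m + 1, k)))
      (by
        intro p hp
        rcases Finset.mem_union.1 hp with hp | hp
        · exact (Nat.lt_succ_self m).trans (hF p hp)
        · obtain ⟨k, -, rfl⟩ := Finset.mem_image.1 hp
          exact Nat.lt_succ_self m)
      (fun p => if p.1 = m + 1 then (Real.sqrt ((2 ^ m)⁻¹) / 2) •
        (L (2 * p.2) + (-1 : ℝ) • L (2 * p.2 + 1)) else M p)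
    have e1 : ∀ z : ℕ × ℕ → W, _ := fun z => sum_union_level (fun ℓ p => ℓ (z p)) (m + 1)
      (N * 2 ^ m) F (fun p hp => (hF p hp).ne') (fun k => (Real.sqrt ((2 ^ m)⁻¹) / 2) •
        (L (2 * k) + (-1 : ℝ) • L (2 * k + 1))) M
    have e2 := sum_union_level (fun (ℓ : StrongDual ℝ W) _ => covForm μ ℓ) (m + 1) (N * 2 ^ m) F
      (fun p hp => (hF p hp).ne') (fun k => (Real.sqrt ((2 ^ m)⁻¹) / 2) •
        (L (2 * k) + (-1 : ℝ) • L (2 * k + 1))) M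
    simp only [e1, e2] at h
    have hN : N * 2 ^ (m + 1) = 2 * (N * 2 ^ m) := by ring
    rw [hN, sum_range_two_mul]
    simp only [sum_range_two_mul]
    convert h using 4 with z
    · congr 2
      rw [← add_assoc, ← Finset.sum_add_distrib]
      congr 1
      refine Finset.sum_congr rfl fun k _ => ?_
      rw [show 2 * k + 1 + 1 = 2 * (k + 1) by ring]
      simp only [midpointWalk_even, midpointWalk_odd, map_sub, map_add, map_smul, smul_eq_mul,
        add_apply, smul_apply]
      ring
    · congr 1
      rw [← add_assoc, Finset.mul_sum, Finset.mul_sum, ← Finset.sum_add_distrib]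
      congr 1
      refine Finset.sum_congr rfl fun k _ => ?_
      have hsq : (Real.sqrt ((2 ^ m)⁻¹) / 2) ^ 2 = (2 ^ m)⁻¹ / 4 := by
        rw [div_pow, Real.sq_sqrt (by positivity)]; norm_num
      rw [covForm_smul, covForm_smul, covForm_add_smul, covForm_add_smul, hsq, pow_succ]
      field_simp
      ring

theorem isGaussianWalk_midpointWalk (hμ : IsCenteredNondegGaussian μ) (x : W) (m : ℕ) :
    IsGaussianWalk μ ((2 ^ m)⁻¹) (midpointWalk x m) (Measure.infinitePi fun _ : ℕ × ℕ => μ) := by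
  intro N L
  have h := integral_cexp_midpointWalk hμ x m N (fun k => if k < N then L k else 0) ∅ (by simp) 0
  have hN : Finset.range (N * 2 ^ m)
      = Finset.range N ∪ Finset.Ico N (N * 2 ^ m) := by
    ext k
    have : N ≤ N * 2 ^ m := Nat.le_mul_of_pos_right _ (by positivity)
    simp only [Finset.mem_range, Finset.mem_union, Finset.mem_Ico]
    omega
  have hd : Disjoint (Finset.range N) (Finset.Ico N (N * 2 ^ m)) := by
    rw [Finset.disjoint_left]
    intro k h1 h2
    simp only [Finset.mem_range, Finset.mem_Ico] at h1 h2
    omega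
  have key : ∀ g : ℕ → StrongDual ℝ W → ℝ, (∀ k, g k 0 = 0) →
      ∑ k ∈ Finset.range (N * 2 ^ m), g k (if k < N then L k else 0)
        = ∑ k ∈ Finset.range N, g k (L k) := by
    intro g hg
    rw [hN, Finset.sum_union hd, Finset.sum_eq_zero (s := Finset.Ico N (N * 2 ^ m)), add_zero]
    · exact Finset.sum_congr rfl fun k hk => by rw [if_pos (Finset.mem_range.1 hk)]
    · intro k hk
      rw [if_neg (not_lt.2 (Finset.mem_Ico.1 hk).1), hg]
  have e1 : ∀ z, _ := fun z => key (fun k ℓ => ℓ (midpointWalk x m (k + 1) z - midpointWalk x m k z))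
    (by simp)
  have e2 := key (fun k ℓ => covForm μ ℓ) (by simp [covForm])
  simp only [e1, e2, Finset.sum_empty, add_zero] at h
  exact h

variable [CompleteSpace W]

/-- The tail of a step of a Gaussian walk, by the fourth moment of `μ`. -/
theorem IsGaussianWalk.measureReal_step_le {Ω : Type*} [MeasurableSpace Ω] {P : Measure Ω}
    [IsProbabilityMeasure P] (hμ : IsCenteredNondegGaussian μ) {δ : ℝ} (hδ : 0 ≤ δ)
    {S : ℕ → Ω → W} (hm : ∀ k, Measurable (S k)) (hS : IsGaussianWalk μ δ S P) (k : ℕ)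
    {ε : ℝ} (hε : 0 < ε) :
    P.real {ω | ε < ‖S (k + 1) ω - S k ω‖} ≤ δ ^ 2 * (∫ w, ‖w‖ ^ 4 ∂μ) / ε ^ 4 := by
  have := hμ.gaussian
  have hmk : Measurable fun ω => S (k + 1) ω - S k ω := (hm _).sub (hm _)
  have hlaw : P.map (fun ω => S (k + 1) ω - S k ω) = μ.map (fun w => Real.sqrt δ • w) := by
    have : IsProbabilityMeasure (P.map (fun ω => S (k + 1) ω - S k ω)) :=
      Measure.isProbabilityMeasure_map hmk.aemeasurable
    have : IsProbabilityMeasure (μ.map (fun w => Real.sqrt δ • w)) :=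
      Measure.isProbabilityMeasure_map (by fun_prop)
    apply Measure.ext_of_charFunDual
    ext ℓ
    rw [charFunDual_apply, integral_map hmk.aemeasurable (by fun_prop), charFunDual_apply,
      integral_map (by fun_prop) (by fun_prop)]
    have h := hμ.charFunDual_eq (Real.sqrt δ • ℓ)
    rw [covForm_smul, Real.sq_sqrt hδ, charFunDual_apply] at h
    have h2 := hS (k + 1) (fun j => if j = k then ℓ else 0)
    have e1 : ∀ ω, ∑ j ∈ Finset.range (k + 1), (if j = k then ℓ else 0) (S (j + 1) ω - S j ω)
        = ℓ (S (k + 1) ω - S k ω) := by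
      intro ω
      rw [Finset.sum_eq_single k] <;> simp +contextual
    have e2 : ∑ j ∈ Finset.range (k + 1), covForm μ (if j = k then ℓ else 0) = covForm μ ℓ := by
      rw [Finset.sum_eq_single k] <;> simp +contextual [covForm]
    simp only [e1, e2] at h2
    rw [h2, ← h]
    simp
  have hset : MeasurableSet {w : W | ε < ‖w‖} := measurableSet_lt (by fun_prop) (by fun_prop)
  have e1 : P.real {ω | ε < ‖S (k + 1) ω - S k ω‖} = μ.real {w | ε < ‖Real.sqrt δ • w‖} := by
    have h1 := map_measureReal_apply (μ := P) hmk hset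
    have h2 := map_measureReal_apply (μ := μ) (f := fun w => Real.sqrt δ • w) (by fun_prop) hset
    rw [hlaw, h2] at h1
    exact h1.symm
  have hint : Integrable (fun w : W => ‖w‖ ^ 4) μ := by
    have := (IsGaussian.memLp_id μ 4 (by simp)).integrable_norm_pow (by simp)
    simpa using this
  have h4 := mul_meas_ge_le_integral_of_nonneg (μ := μ) (f := fun w : W => δ ^ 2 * ‖w‖ ^ 4)
    (ae_of_all _ fun w => by positivity) (hint.const_mul _) (ε ^ 4)
  rw [integral_const_mul] at h4
  rw [e1, le_div_iff₀ (by positivity), mul_comm]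
  refine le_trans (mul_le_mul_of_nonneg_left (measureReal_mono fun w hw => ?_)
    (by positivity)) h4
  simp only [Set.mem_ofPred_eq, norm_smul, Real.norm_eq_abs, abs_of_nonneg (Real.sqrt_nonneg δ)]
    at hw ⊢
  calc ε ^ 4 ≤ (Real.sqrt δ * ‖w‖) ^ 4 := by gcongr
    _ = δ ^ 2 * ‖w‖ ^ 4 := by
      rw [mul_pow, show Real.sqrt δ ^ 4 = (Real.sqrt δ ^ 2) ^ 2 by ring, Real.sq_sqrt hδ]

/-- By Borel–Cantelli, almost surely all steps at level `m` on a bounded time interval are at most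
`(9 / 10) ^ m` for large `m`: there are of order `2 ^ m` of them, each exceeding that bound with
probability of order `(4⁻¹ (9 / 10)⁻⁴) ^ m`. -/
theorem ae_midpointWalk_step_le (hμ : IsCenteredNondegGaussian μ) (x : W) :
    ∀ᵐ z ∂(Measure.infinitePi fun _ : ℕ × ℕ => μ), ∀ N : ℕ, ∀ᶠ m in atTop, ∀ k < N * 2 ^ m,
      ‖midpointWalk x m (k + 1) z - midpointWalk x m k z‖ ≤ (9 / 10 : ℝ) ^ m := by
  have := hμ.gaussian
  rw [ae_all_iff]
  intro N
  set P := Measure.infinitePi fun _ : ℕ × ℕ => μ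
  set A : ℕ → Set (ℕ × ℕ → W) := fun m => ⋃ k ∈ Finset.range (N * 2 ^ m),
    {z | (9 / 10 : ℝ) ^ m < ‖midpointWalk x m (k + 1) z - midpointWalk x m k z‖} with hA
  set C : ℝ := ∫ w, ‖w‖ ^ 4 ∂μ
  have hbound : ∀ m, P.real (A m) ≤ (N * C) * (5000 / 6561 : ℝ) ^ m := by
    intro m
    refine (measureReal_biUnion_finset_le _ _).trans ?_
    refine (Finset.sum_le_sum fun k _ => (isGaussianWalk_midpointWalk hμ x m).measureReal_step_le
      hμ (by positivity) (measurable_midpointWalk x m) k (by positivity)).trans (le_of_eq ?_)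
    rw [Finset.sum_const, Finset.card_range, nsmul_eq_mul]
    push_cast
    have : (5000 / 6561 : ℝ) ^ m = 2 ^ m * ((2 ^ m)⁻¹) ^ 2 / ((9 / 10 : ℝ) ^ m) ^ 4 := by
      rw [← pow_mul, mul_comm m 4, pow_mul, ← inv_pow, ← pow_mul, mul_comm m 2, pow_mul,
        ← mul_pow, ← div_pow]
      norm_num
    rw [this]
    ring
  have hsum : ∑' m, P (A m) ≠ ⊤ := by
    have hs : Summable fun m => (N * C) * (5000 / 6561 : ℝ) ^ m :=
      (summable_geometric_of_lt_one (by norm_num) (by norm_num)).mul_left _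
    have hs' : Summable fun m => P.real (A m) :=
      Summable.of_nonneg_of_le (fun _ => measureReal_nonneg) hbound hs
    have : ∀ m, P (A m) = ENNReal.ofReal (P.real (A m)) := fun m => by simp
    simp only [this]
    exact hs'.tsum_ofReal_ne_top
  filter_upwards [ae_eventually_notMem hsum] with z hz
  filter_upwards [hz] with m hm k hk
  simp only [hA, Set.mem_iUnion, Finset.mem_range, not_exists, Set.mem_ofPred_eq, not_lt] at hm
  exact hm k hk

theorem exists_isBrownianFrom (hμ : IsCenteredNondegGaussian μ) (x : W) :
    ∃ (Ω : Type u) (_ : MeasurableSpace Ω) (P : Measure Ω) (B : ℝ≥0 → Ω → W),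
      IsProbabilityMeasure P ∧ IsBrownianFrom μ x B P := by
  have := hμ.gaussian
  obtain ⟨B, hm, h0, hc, hB⟩ := exists_continuous_limit
    (P := Measure.infinitePi fun _ : ℕ × ℕ => μ) x
    (C := fun m t => midpointWalk x m (dyadicIndex m t))
    (fun m t => measurable_midpointWalk x m _) (by
      filter_upwards [ae_midpointWalk_step_le hμ x] with z hz
      obtain ⟨p, hp0, hpc, hpt⟩ := exists_continuous_path_of_dyadic
        (V := fun m k => midpointWalk x m k z) (by norm_num) (by norm_num)
        (fun m k => midpointWalk_even x m k z) hz
      exact ⟨p, by simpa [midpointWalk] using hp0, hpc, hpt⟩)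
  exact ⟨_, _, _, B, inferInstance, hm, h0, hc, HasBrownianIncrements.of_walks
    (fun m k => measurable_midpointWalk x m k) (isGaussianWalk_midpointWalk hμ x)
    (fun t => hB.mono fun ω h => h t)⟩

end MidpointDisplacement

/-! ### Stopped real paths and their discretisation -/

section StoppedPath

/-- The path `b` stopped when it first enters `(-∞, c)`.  Entering the open half-line, rather than
hitting `c`, makes the stopped path a pointwise limit of its dyadic discretisations. -/
noncomputable def stoppedBelow (b : ℝ≥0 → ℝ) (c : ℝ) (t : ℝ≥0) : ℝ :=
  open Classical in if ∃ s, b s < c then b (min t (sInf {s | b s < c})) else b t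

variable {b : ℝ≥0 → ℝ} {c : ℝ}

theorem continuous_stoppedBelow (hb : Continuous b) : Continuous (stoppedBelow b c) := by
  unfold stoppedBelow
  split_ifs
  · fun_prop
  · exact hb

theorem stoppedBelow_of_not_crossed {t : ℝ≥0} (h : ∀ s ≤ t, c ≤ b s) :
    stoppedBelow b c t = b t := by
  unfold stoppedBelow
  split_ifs with h1
  · rw [min_eq_left]
    refine le_csInf h1 fun s hs => ?_
    by_contra hlt
    exact absurd (h s (not_le.1 hlt).le) (not_le.2 hs)
  · rfl

theorem stoppedBelow_of_crossed (hb : Continuous b) (h0 : c ≤ b 0) {s t : ℝ≥0} (hst : s ≤ t)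
    (hs : b s < c) : stoppedBelow b c t = c := by
  have hne : {s | b s < c}.Nonempty := ⟨s, hs⟩
  set σ := sInf {s | b s < c} with hσ
  have hσs : σ ≤ s := csInf_le (OrderBot.bddBelow _) hs
  unfold stoppedBelow
  rw [if_pos ⟨s, hs⟩, ← hσ, min_eq_right (hσs.trans hst)]
  refine le_antisymm ?_ ?_
  · have h1 : σ ∈ closure {s | b s < c} := csInf_mem_closure hne (OrderBot.bddBelow _)
    exact closure_lt_subset_le hb continuous_const h1
  · rcases eq_or_ne σ 0 with h | h
    · rwa [h]
    · -- `b ≥ c` on `[0, σ)`, hence at `σ`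
      have h1 : ∀ u ∈ Set.Iio σ, c ≤ b u := fun u hu => not_lt.1 fun hlt =>
        (csInf_le (OrderBot.bddBelow _) hlt : σ ≤ u).not_gt hu
      have h2 : σ ∈ closure (Set.Iio σ) := by
        rw [closure_Iio' ⟨0, pos_iff_ne_zero.2 h⟩]
        exact Set.mem_Iic.2 le_rfl
      exact closure_minimal (s := Set.Iio σ) (t := {u | c ≤ b u}) h1
        (isClosed_le continuous_const hb) h2

theorem le_stoppedBelow (hb : Continuous b) (h0 : c ≤ b 0) (t : ℝ≥0) :
    c ≤ stoppedBelow b c t := by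
  by_cases h : ∃ s ≤ t, b s < c
  · obtain ⟨s, hst, hs⟩ := h
    rw [stoppedBelow_of_crossed hb h0 hst hs]
  · push Not at h
    rw [stoppedBelow_of_not_crossed h]
    exact h t le_rfl

/-- The sum of the steps of `β` taken before `β` enters `(-∞, c)`. -/
noncomputable def stoppedSum (β : ℕ → ℝ) (c : ℝ) (K : ℕ) : ℝ :=
  open Classical in
    ∑ k ∈ Finset.range K, if ∃ j ≤ k, β j < c then 0 else β (k + 1) - β k

theorem stoppedSum_of_not_crossed {β : ℕ → ℝ} (h0 : β 0 = 0) {K : ℕ} (h : ∀ j < K, c ≤ β j) :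
    stoppedSum β c K = β K := by
  have : stoppedSum β c K = ∑ k ∈ Finset.range K, (β (k + 1) - β k) := by
    refine Finset.sum_congr rfl fun k hk => if_neg ?_
    rintro ⟨j, hjk, hj⟩
    exact absurd (h j (hjk.trans_lt (Finset.mem_range.1 hk))) (not_le.2 hj)
  rw [this, Finset.sum_range_sub, h0, sub_zero]

theorem exists_stoppedSum_of_crossed {β : ℕ → ℝ} (h0 : β 0 = 0) (hc : c < 0) {K : ℕ}
    (h : ∃ j ≤ K, β j < c) :
    ∃ j, j + 1 ≤ K ∧ stoppedSum β c K = β (j + 1) ∧ β (j + 1) < c ∧ c ≤ β j := by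
  classical
  have hex : ∃ j, β j < c := let ⟨j, _, hj⟩ := h; ⟨j, hj⟩
  have hlt : ∀ j < Nat.find hex, c ≤ β j := fun j hj => not_lt.1 (Nat.find_min hex hj)
  have hle : Nat.find hex ≤ K := by
    obtain ⟨j, hjK, hj⟩ := h
    exact (Nat.find_min' hex hj).trans hjK
  have hpos : Nat.find hex ≠ 0 := by
    intro h1
    have := Nat.find_spec hex
    rw [h1, h0] at this
    exact absurd this (not_lt.2 hc.le)
  obtain ⟨j, hj⟩ := Nat.exists_eq_succ_of_ne_zero hpos
  have hspec := Nat.find_spec hex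
  rw [hj] at hlt hle hspec
  refine ⟨j, hle, ?_, hspec, hlt j (Nat.lt_succ_self j)⟩
  rw [← stoppedSum_of_not_crossed (K := j + 1) h0 hlt, stoppedSum, stoppedSum,
    ← Finset.sum_range_add_sum_Ico _ hle, Finset.sum_eq_zero (s := Finset.Ico _ _), add_zero]
  intro k hk
  exact if_pos ⟨j + 1, (Finset.mem_Ico.1 hk).1, hspec⟩

theorem tendsto_stoppedSum (hb : Continuous b) (h0 : b 0 = 0) (hc : c < 0) (t : ℝ≥0) :
    Tendsto (fun m => stoppedSum (fun k => b ((k : ℝ≥0) / 2 ^ m)) c (dyadicIndex m t)) atTop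
      (𝓝 (stoppedBelow b c t)) := by
  by_cases h : ∃ s ≤ t, b s < c
  · obtain ⟨s, hst, hs⟩ := h
    rw [stoppedBelow_of_crossed hb (h0 ▸ hc.le) hst hs, Metric.tendsto_atTop']
    intro ε hε
    have huc := (isCompact_Icc (a := (0 : ℝ≥0)) (b := t)).uniformContinuousOn_of_continuous
      hb.continuousOn
    obtain ⟨η, hη, hηb⟩ := Metric.uniformContinuousOn_iff.1 huc ε hε
    have h1 : ∀ᶠ m in atTop, b ((dyadicIndex m s : ℝ≥0) / 2 ^ m) < c :=
      (((hb.tendsto s).comp (tendsto_dyadicIndex s)).eventually (gt_mem_nhds hs))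
    have h2 : ∀ᶠ m : ℕ in atTop, ((1 / 2 : ℝ)) ^ m < η :=
      (tendsto_pow_atTop_nhds_zero_of_lt_one (by norm_num) (by norm_num)).eventually
        (gt_mem_nhds hη)
    obtain ⟨m₀, hm₀⟩ := eventually_atTop.1 (h1.and h2)
    refine ⟨m₀, fun m hm => ?_⟩
    obtain ⟨hm1, hm2⟩ := hm₀ m hm.le
    obtain ⟨j, hjK, hj1, hj2, hj3⟩ := exists_stoppedSum_of_crossed
      (β := fun k => b ((k : ℝ≥0) / 2 ^ m)) (K := dyadicIndex m t) (by simp [h0]) hc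
      ⟨dyadicIndex m s, dyadicIndex_mono m hst, hm1⟩
    rw [hj1, Real.dist_eq, abs_sub_comm, abs_of_pos (sub_pos.2 hj2)]
    have hmem : ∀ k ≤ dyadicIndex m t, (k : ℝ≥0) / 2 ^ m ∈ Set.Icc 0 t := fun k hk =>
      ⟨zero_le, le_trans (by gcongr) (dyadicIndex_le m t)⟩
    have := hηb _ (hmem j (by omega)) _ (hmem (j + 1) hjK) (by
      rw [NNReal.dist_eq]
      push_cast
      rw [← sub_div, show (j : ℝ) - (j + 1) = -1 by ring, abs_div, abs_neg, abs_one,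
        abs_of_pos (by positivity)]
      simpa using hm2)
    rw [Real.dist_eq] at this
    have h3 := (abs_lt.1 this).2
    linarith
  · push Not at h
    rw [stoppedBelow_of_not_crossed h]
    refine ((hb.tendsto t).comp (tendsto_dyadicIndex t)).congr fun m => ?_
    refine (stoppedSum_of_not_crossed
      (β := fun k => b ((k : ℝ≥0) / 2 ^ m)) (by simp [h0]) fun j hj => h _ ?_).symm
    exact le_trans (by gcongr) (dyadicIndex_le m t)

end StoppedPath

/-! ### The reflection principle -/

section Reflection

variable {W : Type*} [NormedAddCommGroup W] [NormedSpace ℝ W] [MeasurableSpace W] [BorelSpace W]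
  [SecondCountableTopology W] {Ω : Type*} [mΩ : MeasurableSpace Ω] {P : Measure Ω} {μ : Measure W}

/-- The σ-algebra generated by the first `k` steps. -/
abbrev pastSteps (X : ℕ → Ω → W) (k : ℕ) : MeasurableSpace Ω :=
  MeasurableSpace.comap (fun ω (i : Finset.range k) => X i ω) inferInstance

theorem pastSteps_le {X : ℕ → Ω → W} (hX : ∀ k, Measurable (X k)) (k : ℕ) :
    pastSteps X k ≤ mΩ :=
  (measurable_pi_iff.2 fun i : Finset.range k => hX i).comap_le

theorem measurable_pastSteps {X : ℕ → Ω → W} {i k : ℕ} (h : i < k) :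
    Measurable[pastSteps X k] (X i) :=
  (measurable_pi_apply (⟨i, Finset.mem_range.2 h⟩ : Finset.range k)).comp
    (comap_measurable fun ω (i : Finset.range k) => X i ω)

theorem pastSteps_mono (X : ℕ → Ω → W) : Monotone (pastSteps X) := by
  intro j k hjk
  exact (@measurable_pi_lambda Ω (Finset.range j) (fun _ => W) (pastSteps X k) _ _ fun i =>
    measurable_pastSteps (lt_of_lt_of_le (Finset.mem_range.1 i.2) hjk)).comap_le

/-- Applying to each of a sequence of independent steps a transformation `ρ` preserving its law, or
not, as decided by the previous steps, does not change the joint law. -/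
theorem integral_cexp_predictable [IsProbabilityMeasure P] {X : ℕ → Ω → W}
    (hX : ∀ k, Measurable (X k)) (hind : iIndepFun X P) {ρ : W →L[ℝ] W}
    (hρ : ∀ k, ∀ ℓ : StrongDual ℝ W, ∫ ω, Complex.exp ((ℓ (ρ (X k ω)) : ℝ) * Complex.I) ∂P
      = ∫ ω, Complex.exp ((ℓ (X k ω) : ℝ) * Complex.I) ∂P)
    {A : ℕ → Set Ω} [∀ k ω, Decidable (ω ∈ A k)] (hA : ∀ k, MeasurableSet[pastSteps X k] (A k)) (N : ℕ)
    (L : ℕ → StrongDual ℝ W) :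
    ∫ ω, Complex.exp ((∑ k ∈ Finset.range N,
        L k (if ω ∈ A k then X k ω else ρ (X k ω)) : ℝ) * Complex.I) ∂P
      = ∏ k ∈ Finset.range N, ∫ ω, Complex.exp ((L k (X k ω) : ℝ) * Complex.I) ∂P := by
  induction N with
  | zero => simp
  | succ N ih =>
    set U : Ω → ℂ := fun ω => Complex.exp ((∑ k ∈ Finset.range N,
        L k (if ω ∈ A k then X k ω else ρ (X k ω)) : ℝ) * Complex.I) with hU
    have hUm : Measurable[pastSteps X N] U := by
      refine Complex.measurable_exp.comp (Measurable.mul_const (Complex.measurable_ofReal.comp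
        (Finset.measurable_sum _ fun k hk => (L k).measurable.comp ?_)) _)
      have hk' := Finset.mem_range.1 hk
      have hXk := measurable_pastSteps (X := X) hk'
      exact Measurable.ite (pastSteps_mono X hk'.le _ (hA k)) hXk (ρ.measurable.comp hXk)
    have hpast := pastSteps_le hX N
    have hdisj : Disjoint (Finset.range N) {N} := by simp
    have hi : IndepFun (fun ω (i : Finset.range N) => X i ω) (X N) P :=
      (hind.indepFun_finset _ _ hdisj hX).comp measurable_id
        (measurable_pi_apply (⟨N, Finset.mem_singleton_self N⟩ : ({N} : Finset ℕ)))
    -- the product formula for a function of the past and a function of the new step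
    have hmul : ∀ (V : Ω → ℂ), Measurable[pastSteps X N] V → ∀ ℓ : StrongDual ℝ W,
        ∫ ω, V ω * Complex.exp ((ℓ (X N ω) : ℝ) * Complex.I) ∂P
          = (∫ ω, V ω ∂P) * ∫ ω, Complex.exp ((ℓ (X N ω) : ℝ) * Complex.I) ∂P := by
      intro V hV ℓ
      have h1 : IndepFun V (X N) P := indep_of_indep_of_le_left hi hV.comap_le
      have h2 : IndepFun V (fun ω => Complex.exp ((ℓ (X N ω) : ℝ) * Complex.I)) P :=
        h1.comp (φ := id) (ψ := fun w => Complex.exp ((ℓ w : ℝ) * Complex.I))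
          measurable_id (by fun_prop)
      have h3 := hX N
      exact h2.integral_fun_mul_eq_mul_integral (hV.mono hpast le_rfl).aestronglyMeasurable
        (by fun_prop)
    have hA1 : Measurable[pastSteps X N] ((A N).indicator U) := hUm.indicator (hA N)
    have hA2 : Measurable[pastSteps X N] ((A N)ᶜ.indicator U) := hUm.indicator (hA N).compl
    have hUn : ∀ ω, ‖U ω‖ ≤ 1 := fun ω => norm_cexp_mul_I_le _
    have hint : ∀ (s : Set Ω), MeasurableSet[pastSteps X N] s → ∀ ℓ : StrongDual ℝ W,
        Integrable (fun ω => s.indicator U ω * Complex.exp ((ℓ (X N ω) : ℝ) * Complex.I)) P := by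
      intro s hs ℓ
      have h3 := hX N
      have h4 := ((hUm.indicator hs).mono hpast le_rfl)
      refine Integrable.of_bound (Measurable.aestronglyMeasurable (by fun_prop)) 1
        (ae_of_all _ fun ω => ?_)
      rw [norm_mul, ← mul_one (1 : ℝ)]
      refine mul_le_mul ((norm_indicator_le_norm_self _ _).trans (hUn ω)) (norm_cexp_mul_I_le _)
        (norm_nonneg _) zero_le_one
    have hintU : ∀ (s : Set Ω), MeasurableSet[pastSteps X N] s →
        Integrable (s.indicator U) P := by
      intro s hs
      exact Integrable.of_bound ((hUm.indicator hs).mono hpast le_rfl).aestronglyMeasurable 1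
        (ae_of_all _ fun ω => (norm_indicator_le_norm_self _ _).trans (hUn ω))
    have hsplit : ∀ ω, Complex.exp ((∑ k ∈ Finset.range (N + 1),
        L k (if ω ∈ A k then X k ω else ρ (X k ω)) : ℝ) * Complex.I)
        = (A N).indicator U ω * Complex.exp ((L N (X N ω) : ℝ) * Complex.I)
          + (A N)ᶜ.indicator U ω
            * Complex.exp ((((L N).comp ρ) (X N ω) : ℝ) * Complex.I) := by
      intro ω
      rw [Finset.sum_range_succ, Complex.ofReal_add, add_mul, Complex.exp_add]
      by_cases hω : ω ∈ A N <;> simp [hω, hU]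
    have hρN := hρ N (L N)
    simp only [hsplit]
    rw [integral_add (hint _ (hA N) _) (hint _ (hA N).compl _), hmul _ hA1, hmul _ hA2]
    have e : ∀ ω, ((L N).comp ρ) (X N ω) = L N (ρ (X N ω)) := fun _ => rfl
    simp only [e]
    rw [hρN, ← add_mul, ← integral_add (hintU _ (hA N)) (hintU _ (hA N).compl),
      Finset.prod_range_succ, ← ih]
    congr 1
    refine integral_congr_ae (ae_of_all _ fun ω => ?_)
    exact Set.indicator_self_add_compl_apply (A N) U ω

variable [CompleteSpace W]

/-- The reflection principle in direction `h`, where `f` is the functional of unit variance with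
covariance vector `h`: if `B` is reflected in the hyperplane `f = f x + c` up to the time when it
crosses it, the result is again a Brownian motion.  The sign of each dyadic step is decided by the
previous ones, and `w ↦ w - 2 (f w) h` preserves `μ`; then the mesh tends to `0`. -/
theorem IsBrownianFrom.reflect [IsProbabilityMeasure P] (hμ : IsCenteredNondegGaussian μ) {x : W}
    {B : ℝ≥0 → Ω → W} (hB : IsBrownianFrom μ x B P) {f : StrongDual ℝ W} {h : W}
    (hf : covForm μ f = 1) (hfh : ∀ ℓ : StrongDual ℝ W, ∫ w, ℓ w * f w ∂μ = ℓ h)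
    {c : ℝ} (hc : c < 0) :
    IsBrownianFrom μ (x + (2 * c) • h)
      (fun t ω => B t ω - (2 * stoppedBelow (fun s => f (B s ω - x)) c t - 2 * c) • h) P := by
  classical
  have := hμ.gaussian
  set ρ : W →L[ℝ] W := ContinuousLinearMap.id ℝ W - ((2 : ℝ) • f).smulRight h with hρdef
  have hρ : ∀ w, ρ w = w - (2 * f w) • h := fun w => by simp [hρdef]
  have hcov : ∀ ℓ : StrongDual ℝ W, covForm μ (ℓ.comp ρ) = covForm μ ℓ := by
    intro ℓ
    have h1 : ℓ.comp ρ = ℓ + (-2 * ℓ h) • f := by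
      ext w; simp [hρ]; ring
    rw [h1, covForm_add_smul, hfh, hf]
    ring
  have hb : ∀ ω, Continuous fun s => f (B s ω - x) := fun ω =>
    f.continuous.comp ((hB.continuous_paths ω).sub continuous_const)
  have hb0 : ∀ ω, f (B 0 ω - x) = 0 := fun ω => by simp [hB.start]
  let b : ℕ → Ω → ℕ → ℝ := fun m ω k => f (B ((k : ℝ≥0) / 2 ^ m) ω - x)
  let S : ℕ → ℕ → Ω → W := fun m k ω =>
    B ((k : ℝ≥0) / 2 ^ m) ω - (2 * stoppedSum (b m ω) c k - 2 * c) • h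
  let X : ℕ → ℕ → Ω → W := fun m k ω =>
    B (((k + 1 : ℕ) : ℝ≥0) / 2 ^ m) ω - B ((k : ℝ≥0) / 2 ^ m) ω
  have hXm : ∀ m k, Measurable (X m k) := fun m k => (hB.measurable _).sub (hB.measurable _)
  let A : ℕ → ℕ → Set Ω := fun m k => {ω | ∃ j ≤ k, b m ω j < c}
  have hbX : ∀ m ω j, b m ω j = ∑ i ∈ Finset.range j, f (X m i ω) := by
    intro m ω j
    rw [← map_sum, Finset.sum_range_sub fun k : ℕ => B ((k : ℝ≥0) / 2 ^ m) ω]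
    simp [b, hB.start]
  have hA : ∀ m k, MeasurableSet[pastSteps (X m) k] (A m k) := by
    intro m k
    have h1 : A m k = ⋃ j ∈ Finset.range (k + 1),
        {ω | ∑ i ∈ Finset.range j, f (X m i ω) < c} := by
      ext ω
      simp [A, hbX]
    rw [h1]
    refine Finset.measurableSet_biUnion _ fun j hj => ?_
    have h2 : Measurable[pastSteps (X m) k] fun ω => ∑ i ∈ Finset.range j, f (X m i ω) :=
      Finset.measurable_sum _ fun i hi => f.measurable.comp (measurable_pastSteps (by
        simp only [Finset.mem_range] at hi hj; omega))
    exact h2 measurableSet_Iio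
  have hSm : ∀ m k, Measurable (S m k) := by
    intro m k
    have h1 : Measurable fun ω => stoppedSum (b m ω) c k := by
      unfold stoppedSum
      refine Finset.measurable_sum _ fun j _ => Measurable.ite
        (pastSteps_le (hXm m) j _ (hA m j)) measurable_const ?_
      have h2 := hB.measurable (((j + 1 : ℕ) : ℝ≥0) / 2 ^ m)
      have h3 := hB.measurable ((j : ℝ≥0) / 2 ^ m)
      fun_prop
    have h2 := hB.measurable ((k : ℝ≥0) / 2 ^ m)
    fun_prop
  have hstep : ∀ m k ω, S m (k + 1) ω - S m k ω
      = if ω ∈ A m k then X m k ω else ρ (X m k ω) := by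
    intro m k ω
    have h1 : stoppedSum (b m ω) c (k + 1) = stoppedSum (b m ω) c k
        + if ω ∈ A m k then 0 else f (X m k ω) := by
      rw [stoppedSum, Finset.sum_range_succ]
      congr 1
      by_cases hω : ω ∈ A m k
      · rw [if_pos hω]
        exact if_pos hω
      · rw [if_neg hω]
        refine (if_neg hω).trans ?_
        simp [b, X]
    simp only [S, h1]
    by_cases hω : ω ∈ A m k
    · simp [hω, X]
    · simp only [hω, if_false, hρ, X]
      module
  have hwalk : ∀ m, IsGaussianWalk μ ((2 ^ m)⁻¹) (S m) P := by
    intro m N L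
    have hgw := hB.increments.isGaussianWalk m
    have hind : iIndepFun (X m) P :=
      (hB.isBanachBrownianMotion hμ).indep_increments.nat
        (t := fun k : ℕ => (k : ℝ≥0) / 2 ^ m) fun i j hij => by dsimp only; gcongr
    have hone : ∀ k (ℓ : StrongDual ℝ W), ∫ ω, Complex.exp ((ℓ (X m k ω) : ℝ) * Complex.I) ∂P
        = (Real.exp (-((2 ^ m)⁻¹ * covForm μ ℓ) / 2) : ℝ) := by
      intro k ℓ
      have h2 := hgw (k + 1) (fun j => if j = k then ℓ else 0)
      have e1 : ∀ ω, ∑ j ∈ Finset.range (k + 1), (if j = k then ℓ else 0)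
          (B (((j + 1 : ℕ) : ℝ≥0) / 2 ^ m) ω - B ((j : ℝ≥0) / 2 ^ m) ω) = ℓ (X m k ω) := by
        intro ω
        rw [Finset.sum_eq_single k] <;> simp +contextual [X]
      have e2 : ∑ j ∈ Finset.range (k + 1), covForm μ (if j = k then ℓ else 0) = covForm μ ℓ := by
        rw [Finset.sum_eq_single k] <;> simp +contextual [covForm]
      simpa only [e1, e2] using h2
    have h1 := integral_cexp_predictable (hXm m) hind (ρ := ρ) (fun k ℓ => by
      have := hone k (ℓ.comp ρ)
      rw [hcov, ← hone k ℓ] at this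
      exact this) (hA m) N L
    simp only [hstep]
    rw [h1]
    simp only [hone]
    rw [← Complex.ofReal_prod, ← Real.exp_sum, ← Finset.sum_div, Finset.sum_neg_distrib,
      Finset.mul_sum]
  have hlim : ∀ t ω, Tendsto (fun m => S m (dyadicIndex m t) ω) atTop
      (𝓝 (B t ω - (2 * stoppedBelow (fun s => f (B s ω - x)) c t - 2 * c) • h)) := by
    intro t ω
    have h1 := ((hB.continuous_paths ω).tendsto t).comp (tendsto_dyadicIndex t)
    have h2 := tendsto_stoppedSum (hb ω) (hb0 ω) hc t
    exact h1.sub ((((h2.const_mul 2).sub_const _)).smul_const h)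
  refine ⟨fun t => measurable_of_tendsto_metrizable (fun m => hSm m (dyadicIndex m t))
      (tendsto_pi_nhds.2 fun ω => hlim t ω), fun ω => ?_, fun ω => ?_,
    HasBrownianIncrements.of_walks hSm hwalk fun t => ae_of_all _ fun ω => hlim t ω⟩
  · rw [stoppedBelow_of_not_crossed (by
      intro s hs
      obtain rfl : s = 0 := le_antisymm hs zero_le
      rw [hb0]; exact hc.le), hb0, hB.start]
    module
  · have := continuous_stoppedBelow (c := c) (hb ω)
    have := hB.continuous_paths ω
    fun_prop

end Reflection

/-! ### Crossing probabilities and one reflection coupling -/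

section Gaussian

theorem gaussianReal_Icc_le {T : ℝ≥0} (hT : 0 < T) (c : ℝ) :
    gaussianReal 0 T (Set.Icc c (-c)) ≤ ENNReal.ofReal (-c / Real.sqrt T) := by
  rw [gaussianReal_apply 0 hT.ne']
  have hTr : (0 : ℝ) < T := hT
  have hpdf : ∀ y, gaussianPDF 0 T y ≤ ENNReal.ofReal ((2 * Real.sqrt T)⁻¹) := by
    intro y
    refine ENNReal.ofReal_le_ofReal ?_
    rw [gaussianPDFReal]
    have h1 : Real.exp (-(y - 0) ^ 2 / (2 * T)) ≤ 1 :=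
      Real.exp_le_one_iff.2 (by rw [neg_div]; exact neg_nonpos.2 (by positivity))
    have h2 : 2 * Real.sqrt T ≤ Real.sqrt (2 * Real.pi * T) := by
      refine Real.le_sqrt_of_sq_le ?_
      rw [mul_pow, Real.sq_sqrt hTr.le]
      nlinarith [Real.pi_gt_three]
    calc (Real.sqrt (2 * Real.pi * T))⁻¹ * Real.exp (-(y - 0) ^ 2 / (2 * T))
        ≤ (2 * Real.sqrt T)⁻¹ * 1 := by gcongr
      _ = _ := mul_one _
  refine (lintegral_mono hpdf).trans ?_
  rw [setLIntegral_const, Real.volume_Icc, ← ENNReal.ofReal_mul (by positivity)]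
  refine ENNReal.ofReal_le_ofReal (le_of_eq ?_)
  have : Real.sqrt T ≠ 0 := (Real.sqrt_pos.2 hTr).ne'
  field_simp
  ring

theorem gaussianReal_abs_ge_le (T : ℝ≥0) {r : ℝ} (hr : 0 < r) :
    gaussianReal 0 T {y | r ≤ |y|} ≤ ENNReal.ofReal (T / r ^ 2) := by
  have h := meas_ge_le_variance_div_sq (μ := gaussianReal 0 T) (X := id)
    (memLp_id_gaussianReal 2) hr
  rw [variance_id_gaussianReal] at h
  simpa using h

end Gaussian

section Crossing

variable {W : Type*} [NormedAddCommGroup W] [NormedSpace ℝ W] [MeasurableSpace W] [BorelSpace W]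
  [SecondCountableTopology W] [CompleteSpace W] {Ω : Type*} [MeasurableSpace Ω] {P : Measure Ω}
  {μ : Measure W} [IsProbabilityMeasure P] {x : W} {B : ℝ≥0 → Ω → W} {f : StrongDual ℝ W} {h : W}

theorem IsBrownianFrom.map_dual (hB : IsBrownianFrom μ x B P) (hf : covForm μ f = 1) (T : ℝ≥0) :
    P.map (fun ω => f (B T ω - x)) = gaussianReal 0 T := by
  have hm : Measurable fun ω => f (B T ω - x) :=
    f.measurable.comp ((hB.measurable T).sub_const x)
  have : IsProbabilityMeasure (P.map fun ω => f (B T ω - x)) :=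
    Measure.isProbabilityMeasure_map hm.aemeasurable
  apply Measure.ext_of_charFun
  ext s
  have h1 := hB.increments.charFunDual_sub hB.measurable (zero_le : 0 ≤ T) (s • f)
  have hm' : Measurable fun ω => B T ω - B 0 ω := (hB.measurable T).sub (hB.measurable 0)
  rw [charFunDual_apply, integral_map hm'.aemeasurable (by fun_prop), covForm_smul, hf] at h1
  rw [charFun_apply_real, integral_map hm.aemeasurable (by fun_prop), charFun_gaussianReal]
  simp only [hB.start, smul_apply, smul_eq_mul] at h1
  push_cast at h1
  rw [h1]
  congr 1
  simp
  ring

/-- Along the reflected motion, the coordinate `f` is the coordinate of the original one minus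
twice its stopped version. -/
theorem dual_reflect (hf : covForm μ f = 1)
    (hfh : ∀ ℓ : StrongDual ℝ W, ∫ w, ℓ w * f w ∂μ = ℓ h) (w : W) (c g : ℝ) :
    f (w - (2 * g - 2 * c) • h - (x + (2 * c) • h)) = f (w - x) - 2 * g := by
  have hfh1 : f h = 1 := by
    rw [← hfh f, ← hf, covForm]
    simp only [pow_two]
  simp only [map_sub, map_add, map_smul, smul_eq_mul, hfh1]
  ring

/-- After a crossing of `c` before time `T`, the coordinates at `T` of the motion and of its
reflection differ by `2 c`, so one of them is at distance at least `-c` from `0`; each is Gaussian of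
variance `T`. -/
theorem IsBrownianFrom.measure_crossed_le (hμ : IsCenteredNondegGaussian μ)
    (hB : IsBrownianFrom μ x B P) (hf : covForm μ f = 1)
    (hfh : ∀ ℓ : StrongDual ℝ W, ∫ w, ℓ w * f w ∂μ = ℓ h) {c : ℝ} (hc : c < 0) (T : ℝ≥0) :
    P {ω | ∃ t ≤ T, f (B t ω - x) < c} ≤ ENNReal.ofReal (2 * T / c ^ 2) := by
  have hB' := hB.reflect hμ hf hfh hc
  set G : ℝ≥0 → Ω → ℝ := fun t ω => stoppedBelow (fun s => f (B s ω - x)) c t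
  have hset : MeasurableSet {y : ℝ | -c ≤ |y|} := measurableSet_le measurable_const (by fun_prop)
  have hm : Measurable fun ω => f (B T ω - x) :=
    f.measurable.comp ((hB.measurable T).sub_const x)
  have hm' : Measurable fun ω => f (B T ω - (2 * G T ω - 2 * c) • h - (x + (2 * c) • h)) :=
    f.measurable.comp ((hB'.measurable T).sub_const _)
  have h1 : P {ω | -c ≤ |f (B T ω - x)|} ≤ ENNReal.ofReal (T / c ^ 2) := by
    have := gaussianReal_abs_ge_le T (neg_pos.2 hc)
    rwa [← hB.map_dual hf T, Measure.map_apply hm hset, neg_sq] at this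
  have h2 : P {ω | -c ≤ |f (B T ω - (2 * G T ω - 2 * c) • h - (x + (2 * c) • h))|}
      ≤ ENNReal.ofReal (T / c ^ 2) := by
    have := gaussianReal_abs_ge_le T (neg_pos.2 hc)
    rwa [← hB'.map_dual hf T, Measure.map_apply hm' hset, neg_sq] at this
  have hsub : {ω | ∃ t ≤ T, f (B t ω - x) < c} ⊆ {ω | -c ≤ |f (B T ω - x)|}
      ∪ {ω | -c ≤ |f (B T ω - (2 * G T ω - 2 * c) • h - (x + (2 * c) • h))|} := by
    rintro ω ⟨t, htT, ht⟩
    have hb : Continuous fun s => f (B s ω - x) :=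
      f.continuous.comp ((hB.continuous_paths ω).sub continuous_const)
    have hG : G T ω = c := stoppedBelow_of_crossed hb (by simp [hB.start, hc.le]) htT ht
    simp only [Set.mem_union, Set.mem_ofPred_eq, dual_reflect hf hfh, hG]
    rcases le_total (f (B T ω - x)) c with h3 | h3
    · left
      rw [abs_of_neg (h3.trans_lt hc)]
      linarith
    · right
      refine le_trans ?_ (le_abs_self _)
      linarith
  refine (measure_mono hsub).trans ((measure_union_le _ _).trans ((add_le_add h1 h2).trans ?_))
  rw [← ENNReal.ofReal_add (by positivity) (by positivity)]
  refine ENNReal.ofReal_le_ofReal (le_of_eq ?_)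
  ring

/-- If the coordinate at time `T` of the motion is below `c`, or that of its reflection above `-c`,
then `c` has been crossed.  These events are disjoint and leave out the Gaussian mass of
`[c, -c]`. -/
theorem IsBrownianFrom.measure_not_crossed_le (hμ : IsCenteredNondegGaussian μ)
    (hB : IsBrownianFrom μ x B P) (hf : covForm μ f = 1)
    (hfh : ∀ ℓ : StrongDual ℝ W, ∫ w, ℓ w * f w ∂μ = ℓ h) {c : ℝ} (hc : c < 0) {T : ℝ≥0}
    (hT : 0 < T) :
    P {ω | ∀ t ≤ T, c ≤ f (B t ω - x)} ≤ ENNReal.ofReal (-c / Real.sqrt T) := by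
  have hB' := hB.reflect hμ hf hfh hc
  set G : ℝ≥0 → Ω → ℝ := fun t ω => stoppedBelow (fun s => f (B s ω - x)) c t
  have hm : Measurable fun ω => f (B T ω - x) :=
    f.measurable.comp ((hB.measurable T).sub_const x)
  have hm' : Measurable fun ω => f (B T ω - (2 * G T ω - 2 * c) • h - (x + (2 * c) • h)) :=
    f.measurable.comp ((hB'.measurable T).sub_const _)
  set A : Set Ω := {ω | f (B T ω - x) < c} with hA
  set A' : Set Ω := {ω | -c < f (B T ω - (2 * G T ω - 2 * c) • h - (x + (2 * c) • h))} with hA'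
  have hAm : MeasurableSet A := hm measurableSet_Iio
  have hAm' : MeasurableSet A' := hm' measurableSet_Ioi
  have hb : ∀ ω, Continuous fun s => f (B s ω - x) := fun ω =>
    f.continuous.comp ((hB.continuous_paths ω).sub continuous_const)
  -- the two events are disjoint, and both contained in the event of a crossing before `T`
  have hdisj : Disjoint A A' := by
    rw [Set.disjoint_left]
    intro ω h1 h2
    have hG : G T ω = c := stoppedBelow_of_crossed (hb ω) (by simp [hB.start, hc.le]) le_rfl h1
    simp only [hA', hA, Set.mem_ofPred_eq, dual_reflect hf hfh, hG] at h1 h2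
    linarith
  have hsub : {ω | ∀ t ≤ T, c ≤ f (B t ω - x)} ⊆ (A ∪ A')ᶜ := by
    intro ω hω h1
    have hG : G T ω = f (B T ω - x) := stoppedBelow_of_not_crossed hω
    have h2 := hω T le_rfl
    simp only [hA', hA, Set.mem_union, Set.mem_ofPred_eq, dual_reflect hf hfh, hG] at h1
    rcases h1 with h1 | h1 <;> linarith
  have hPA : P A = gaussianReal 0 T (Set.Iio c) := by
    rw [← hB.map_dual hf T, Measure.map_apply hm measurableSet_Iio]
    rfl
  have hPA' : P A' = gaussianReal 0 T (Set.Ioi (-c)) := by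
    rw [← hB'.map_dual hf T, Measure.map_apply hm' measurableSet_Ioi]
    rfl
  have hIcc : Set.Icc c (-c) = (Set.Iio c ∪ Set.Ioi (-c))ᶜ := by
    ext y; simp
  calc P {ω | ∀ t ≤ T, c ≤ f (B t ω - x)} ≤ P (A ∪ A')ᶜ := measure_mono hsub
    _ = gaussianReal 0 T (Set.Icc c (-c)) := by
      rw [prob_compl_eq_one_sub (hAm.union hAm'), measure_union hdisj hAm', hPA, hPA', hIcc,
        prob_compl_eq_one_sub (measurableSet_Iio.union measurableSet_Ioi),
        measure_union _ measurableSet_Ioi]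
      rw [Set.disjoint_left]
      intro y h1 h2
      simp only [Set.mem_Iio, Set.mem_Ioi] at h1 h2
      linarith
    _ ≤ _ := gaussianReal_Icc_le hT c

theorem IsBrownianFrom.ae_exists_crossed (hμ : IsCenteredNondegGaussian μ)
    (hB : IsBrownianFrom μ x B P) (hf : covForm μ f = 1)
    (hfh : ∀ ℓ : StrongDual ℝ W, ∫ w, ℓ w * f w ∂μ = ℓ h) {c : ℝ} (hc : c < 0) :
    ∀ᵐ ω ∂P, ∃ t, f (B t ω - x) < c := by
  rw [ae_iff]
  have h1 : ∀ n : ℕ, 1 ≤ n → P {ω | ¬∃ t, f (B t ω - x) < c} ≤ ENNReal.ofReal (-c / n) := by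
    intro n hn
    have hn' : (0 : ℝ≥0) < (n : ℝ≥0) ^ 2 := by positivity
    refine (measure_mono ?_).trans ((hB.measure_not_crossed_le hμ hf hfh hc hn').trans ?_)
    · intro ω hω t _
      exact not_lt.1 fun hlt => hω ⟨t, hlt⟩
    · push_cast
      rw [Real.sqrt_sq (by positivity)]
  have h2 : Tendsto (fun n : ℕ => ENNReal.ofReal (-c / n)) atTop (𝓝 0) := by
    simpa using ENNReal.tendsto_ofReal (tendsto_const_div_atTop_nhds_zero_nat (-c))
  exact le_antisymm (ge_of_tendsto h2 (eventually_atTop.2 ⟨1, h1⟩)) zero_le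

/-- A reflection coupling with initial distance `v`, a vector of the range of the covariance
operator.  The distance is a random multiple of `v`; it vanishes after an almost surely finite time,
and the multiple is large with small probability only, uniformly in `v`. -/
theorem IsBrownianFrom.exists_coupling (hμ : IsCenteredNondegGaussian μ)
    (hB : IsBrownianFrom μ x B P) {ℓ : StrongDual ℝ W} {v : W}
    (hv : ∀ m : StrongDual ℝ W, ∫ w, m w * ℓ w ∂μ = m v) {r : ℝ} (hr0 : 0 < r) (hr1 : r ≤ 1) :
    ∃ B' : ℝ≥0 → Ω → W, IsBrownianFrom μ (x - v) B' P ∧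
      (∀ᵐ ω ∂P, ∀ᶠ t in atTop, B' t ω = B t ω) ∧
      P {ω | ∃ t, 3 / r ^ 2 * ‖v‖ < ‖B t ω - B' t ω‖} ≤ ENNReal.ofReal (2 * r) := by
  by_cases hℓ : ℓ = 0
  · have hv0 : v = 0 := SeparatingDual.eq_zero_of_forall_dual_eq_zero (R := ℝ) fun m => by
      rw [← hv m, hℓ]; simp
    refine ⟨B, by simpa [hv0] using hB, by simp, ?_⟩
    simp [hv0]
  · have hpos : 0 < covForm μ ℓ := hμ.nondegenerate ℓ hℓ
    set a := Real.sqrt (covForm μ ℓ) with ha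
    have ha0 : 0 < a := Real.sqrt_pos.2 hpos
    have ha2 : a ^ 2 = covForm μ ℓ := Real.sq_sqrt hpos.le
    set f : StrongDual ℝ W := a⁻¹ • ℓ with hfdef
    set h : W := a⁻¹ • v with hhdef
    have hf : covForm μ f = 1 := by
      rw [covForm_smul, ← ha2]; field_simp
    have hfh : ∀ m : StrongDual ℝ W, ∫ w, m w * f w ∂μ = m h := by
      intro m
      rw [hhdef, map_smul, ← hv m, smul_eq_mul, ← integral_const_mul]
      refine integral_congr_ae (ae_of_all _ fun w => ?_)
      simp [hfdef]; ring
    have hc : -(a / 2) < 0 := by linarith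
    have hB' := hB.reflect hμ hf hfh hc
    have hstart : x + (2 * -(a / 2)) • h = x - v := by
      rw [hhdef, smul_smul, show 2 * -(a / 2) * a⁻¹ = -1 by field_simp]
      module
    rw [hstart] at hB'
    have hb : ∀ ω, Continuous fun s => f (B s ω - x) := fun ω =>
      f.continuous.comp ((hB.continuous_paths ω).sub continuous_const)
    have hb0 : ∀ ω, -(a / 2) ≤ f (B 0 ω - x) := fun ω => by
      simp only [hB.start, sub_self, map_zero]; linarith
    refine ⟨_, hB', ?_, ?_⟩
    · filter_upwards [hB.ae_exists_crossed hμ hf hfh hc] with ω ⟨s, hs⟩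
      filter_upwards [eventually_ge_atTop s] with t hst
      rw [stoppedBelow_of_crossed (hb ω) (hb0 ω) hst hs]
      simp
    · -- by time `T` the motions have met, and until then the coordinate stays below `a / r ^ 2`
      set T : ℝ≥0 := ⟨a ^ 2 / (4 * r ^ 2), by positivity⟩ with hT
      have hTc : (T : ℝ) = a ^ 2 / (4 * r ^ 2) := rfl
      have hT0 : 0 < T := by
        rw [← NNReal.coe_pos, hTc]; positivity
      have hsqrt : Real.sqrt T = a / (2 * r) := by
        rw [hTc, show a ^ 2 / (4 * r ^ 2) = (a / (2 * r)) ^ 2 by ring, Real.sqrt_sq (by positivity)]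
      have h1 := hB.measure_not_crossed_le hμ hf hfh hc hT0
      have h2 := hB.measure_crossed_le (f := -f) (h := -h) (c := -(a / r ^ 2)) hμ
        (by rw [← hf, ← neg_one_smul ℝ f, covForm_smul]; ring)
        (fun m => by simp [← hfh m, integral_neg]) (neg_neg_of_pos (by positivity)) T
      have hsub : {ω | ∃ t, 3 / r ^ 2 * ‖v‖ < ‖B t ω - (B t ω
            - (2 * stoppedBelow (fun s => f (B s ω - x)) (-(a / 2)) t - 2 * -(a / 2)) • h)‖}
          ⊆ {ω | ∀ t ≤ T, -(a / 2) ≤ f (B t ω - x)}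
            ∪ {ω | ∃ t ≤ T, (-f) (B t ω - x) < -(a / r ^ 2)} := by
        rintro ω ⟨t, ht⟩
        by_contra hcon
        simp only [Set.mem_union, Set.mem_ofPred_eq, not_or, not_forall, not_exists, not_and,
          not_le, not_lt] at hcon
        obtain ⟨⟨s, hsT, hs⟩, hlow⟩ := hcon
        refine absurd ht (not_lt.2 ?_)
        set g := stoppedBelow (fun s => f (B s ω - x)) (-(a / 2)) t with hg
        have hg0 : -(a / 2) ≤ g := le_stoppedBelow (hb ω) (hb0 ω) t
        have hg1 : g ≤ a / r ^ 2 := by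
          by_cases hcr : ∃ s ≤ t, f (B s ω - x) < -(a / 2)
          · obtain ⟨u, hut, hu⟩ := hcr
            rw [hg, stoppedBelow_of_crossed (hb ω) (hb0 ω) hut hu]
            have : 0 < a / r ^ 2 := by positivity
            linarith
          · push Not at hcr
            rw [hg, stoppedBelow_of_not_crossed hcr]
            have htT : t ≤ T := by
              by_contra hlt
              exact absurd (hcr s (hsT.trans (not_le.1 hlt).le)) (not_le.2 hs)
            have := hlow t htT
            rw [neg_apply] at this
            linarith
        rw [sub_sub_cancel, norm_smul, hhdef, norm_smul, Real.norm_eq_abs, Real.norm_eq_abs,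
          abs_of_nonneg (by linarith), abs_of_pos (inv_pos.2 ha0), ← mul_assoc]
        refine mul_le_mul_of_nonneg_right ?_ (norm_nonneg v)
        have hr2 : 1 ≤ 1 / r ^ 2 := by
          rw [le_div_iff₀ (by positivity), one_mul]
          exact pow_le_one₀ hr0.le hr1
        calc (2 * g - 2 * -(a / 2)) * a⁻¹ ≤ (2 * (a / r ^ 2) - 2 * -(a / 2)) * a⁻¹ := by gcongr
          _ = 2 * (1 / r ^ 2) + 1 := by field_simp; ring
          _ ≤ 3 / r ^ 2 := by
            rw [show (3 : ℝ) / r ^ 2 = 3 * (1 / r ^ 2) by ring]; linarith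
      refine (measure_mono hsub).trans ((measure_union_le _ _).trans ((add_le_add h1 h2).trans ?_))
      rw [← ENNReal.ofReal_add (by rw [hsqrt, neg_neg]; positivity) (by positivity)]
      refine ENNReal.ofReal_le_ofReal ?_
      rw [hsqrt, hTc]
      have e1 : - -(a / 2) / (a / (2 * r)) = r := by field_simp
      have e2 : 2 * (a ^ 2 / (4 * r ^ 2)) / (-(a / r ^ 2)) ^ 2 = r ^ 2 / 2 := by
        field_simp; ring
      rw [e1, e2]
      nlinarith

end Crossing

/-! ### Iterating reflection couplings -/

section Iteration

variable {W : Type*} [NormedAddCommGroup W] [NormedSpace ℝ W] [MeasurableSpace W] [BorelSpace W]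
  [SecondCountableTopology W] [CompleteSpace W] {Ω : Type*} [MeasurableSpace Ω] {P : Measure Ω}
  {μ : Measure W}

theorem exists_covariance_vector (hμ : IsCenteredNondegGaussian μ) (ℓ : StrongDual ℝ W) :
    ∃ v : W, ∀ m : StrongDual ℝ W, ∫ w, m w * ℓ w ∂μ = m v := by
  have := hμ.gaussian
  have hint : Integrable (fun w => ℓ w • w) μ := memLp_one_iff_integrable.1
    ((IsGaussian.memLp_two_id (μ := μ)).smul (IsGaussian.memLp_dual μ ℓ 2 (by simp)))
  refine ⟨∫ w, ℓ w • w ∂μ, fun m => ?_⟩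
  rw [← m.integral_comp_comm hint]
  simp [mul_comm]

/-- The range of the covariance operator is dense, because `μ` is non-degenerate: a functional `g`
vanishing on the range has variance zero. -/
theorem exists_covariance_vector_near (hμ : IsCenteredNondegGaussian μ) (y : W) {ε : ℝ}
    (hε : 0 < ε) :
    ∃ (ℓ : StrongDual ℝ W) (v : W), (∀ m : StrongDual ℝ W, ∫ w, m w * ℓ w ∂μ = m v) ∧
      ‖y - v‖ < ε := by
  have := hμ.gaussian
  let S : Submodule ℝ W :=
    { carrier := {v | ∃ ℓ : StrongDual ℝ W, ∀ m : StrongDual ℝ W, ∫ w, m w * ℓ w ∂μ = m v}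
      add_mem' := by
        rintro v v' ⟨ℓ, hℓ⟩ ⟨ℓ', hℓ'⟩
        refine ⟨ℓ + ℓ', fun m => ?_⟩
        rw [map_add, ← hℓ, ← hℓ',
          ← integral_add (integrable_dual_mul m ℓ) (integrable_dual_mul m ℓ')]
        simp [mul_add]
      zero_mem' := ⟨0, by simp⟩
      smul_mem' := by
        rintro c v ⟨ℓ, hℓ⟩
        refine ⟨c • ℓ, fun m => ?_⟩
        rw [map_smul, ← hℓ, smul_eq_mul, ← integral_const_mul]
        refine integral_congr_ae (ae_of_all _ fun w => ?_)
        simp only [smul_apply, smul_eq_mul]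
        ring }
  suffices h : y ∈ closure (S : Set W) by
    obtain ⟨v, ⟨ℓ, hℓ⟩, hv⟩ := Metric.mem_closure_iff.1 h ε hε
    exact ⟨ℓ, v, hℓ, by rwa [← dist_eq_norm]⟩
  by_contra hy
  obtain ⟨g, u, hgS, hgy⟩ := geometric_hahn_banach_closed_point
    (S.topologicalClosure.convex) S.isClosed_topologicalClosure hy
  have hS : ∀ v ∈ S, g v < u := fun v hv => hgS v (subset_closure hv)
  have hg : g ≠ 0 := by
    rintro rfl
    have := hS 0 S.zero_mem
    simp only [zero_apply] at this hgy
    linarith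
  obtain ⟨v, hv⟩ := exists_covariance_vector hμ g
  have hpos : 0 < g v := by
    rw [← hv g]
    simpa only [pow_two] using hμ.nondegenerate g hg
  have := hS ((u / g v) • v) (S.smul_mem _ ⟨g, hv⟩)
  rw [map_smul, smul_eq_mul, div_mul_cancel₀ _ hpos.ne'] at this
  exact lt_irrefl _ this

theorem tendstoUniformly_of_geometric {T : Type*} {b : ℕ → T → W} {p : T → W} {K : ℝ}
    (h : ∀ᶠ j in atTop, ∀ t, ‖b j t - b (j + 1) t‖ ≤ K * (1 / 4) ^ j)
    (hp : ∀ t, Tendsto (fun j => b j t) atTop (𝓝 (p t))) : TendstoUniformly b p atTop := by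
  obtain ⟨j₀, hj₀⟩ := eventually_atTop.1 h
  rw [Metric.tendstoUniformly_iff]
  intro ε hε
  have hlim : Tendsto (fun j : ℕ => K * (1 / 4 : ℝ) ^ j / (1 - 1 / 4)) atTop (𝓝 0) := by
    simpa using ((tendsto_pow_atTop_nhds_zero_of_lt_one (r := (1 / 4 : ℝ)) (by norm_num)
      (by norm_num)).const_mul K).div_const (1 - 1 / 4)
  filter_upwards [hlim.eventually (gt_mem_nhds hε), eventually_ge_atTop j₀] with j hj1 hj2 t
  rw [dist_comm]
  refine lt_of_le_of_lt ?_ hj1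
  have := dist_le_of_le_geometric_of_tendsto₀ (f := fun i => b (i + j) t) (1 / 4)
    (K * (1 / 4) ^ j) (by norm_num) (fun i => ?_) ((tendsto_add_atTop_iff_nat j).2 (hp t))
  · simpa using this
  · rw [dist_eq_norm, show i + 1 + j = i + j + 1 by omega]
    refine (hj₀ (i + j) (by omega) t).trans (le_of_eq ?_)
    ring

theorem exists_tendsto_of_geometric {T : Type*} {b : ℕ → T → W} {K : ℝ}
    (h : ∀ᶠ j in atTop, ∀ t, ‖b j t - b (j + 1) t‖ ≤ K * (1 / 4) ^ j) :
    ∃ p : T → W, ∀ t, Tendsto (fun j => b j t) atTop (𝓝 (p t)) := by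
  obtain ⟨j₀, hj₀⟩ := eventually_atTop.1 h
  have : ∀ t, ∃ w, Tendsto (fun j => b j t) atTop (𝓝 w) := by
    intro t
    have hc : CauchySeq fun i => b (i + j₀) t := by
      refine cauchySeq_of_le_geometric (1 / 4) (K * (1 / 4) ^ j₀) (by norm_num) fun i => ?_
      rw [dist_eq_norm, show i + 1 + j₀ = i + j₀ + 1 by omega]
      refine (hj₀ (i + j₀) (by omega) t).trans (le_of_eq ?_)
      ring
    obtain ⟨w, hw⟩ := cauchySeq_tendsto_of_complete hc
    exact ⟨w, (tendsto_add_atTop_iff_nat j₀).1 hw⟩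
  choose p hp using this
  exact ⟨p, hp⟩

/-- Successive reflection couplings produce Brownian motions with starting points approaching `y`
at a geometric rate. -/
theorem IsBrownianFrom.exists_coupling_sequence [IsProbabilityMeasure P]
    (hμ : IsCenteredNondegGaussian μ) {x : W} {B : ℝ≥0 → Ω → W} (hB : IsBrownianFrom μ x B P)
    (y : W) {D : ℝ} (hD : 0 < D) (hxy : ‖x - y‖ ≤ D) :
    ∃ (z : ℕ → W) (C : ℕ → ℝ≥0 → Ω → W), C 0 = B ∧ Tendsto z atTop (𝓝 y) ∧
      (∀ j, IsBrownianFrom μ (z j) (C j) P) ∧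
      (∀ j, ∀ᵐ ω ∂P, ∀ᶠ t in atTop, C (j + 1) t ω = C j t ω) ∧
      ∀ j, P {ω | ∃ t, 6 * D * (1 / 4) ^ j < ‖C j t ω - C (j + 1) t ω‖}
        ≤ ENNReal.ofReal (2 * (1 / 2) ^ j) := by
  let State : ℕ → Type _ := fun j => {p : W × (ℝ≥0 → Ω → W) //
    IsBrownianFrom μ p.1 p.2 P ∧ ‖p.1 - y‖ ≤ D * (1 / 16) ^ j}
  have hstep : ∀ (j : ℕ) (p : State j), ∃ q : State (j + 1),
      (∀ᵐ ω ∂P, ∀ᶠ t in atTop, q.1.2 t ω = p.1.2 t ω) ∧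
      P {ω | ∃ t, 6 * D * (1 / 4) ^ j < ‖p.1.2 t ω - q.1.2 t ω‖}
        ≤ ENNReal.ofReal (2 * (1 / 2) ^ j) := by
    rintro j ⟨⟨a, A⟩, hA, ha⟩
    dsimp only at hA ha ⊢
    obtain ⟨ℓ, v, hv, hav⟩ := exists_covariance_vector_near hμ (a - y)
      (show 0 < D * (1 / 16) ^ (j + 1) by positivity)
    obtain ⟨A', hA', hmeet, hbad⟩ := hA.exists_coupling hμ hv (r := (1 / 2) ^ j) (by positivity)
      (pow_le_one₀ (by norm_num) (by norm_num))
    refine ⟨⟨(a - v, A'), hA', ?_⟩, hmeet, (measure_mono ?_).trans hbad⟩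
    · rw [sub_right_comm]; exact hav.le
    · rintro ω ⟨t, ht⟩
      refine ⟨t, lt_of_le_of_lt ?_ ht⟩
      have h1 : ‖v‖ ≤ 2 * (D * (1 / 16) ^ j) := by
        have h2 : ‖v‖ ≤ ‖a - y‖ + ‖a - y - v‖ := by
          have := norm_sub_le (a - y) (a - y - v)
          rwa [sub_sub_cancel] at this
        have h3 : D * (1 / 16 : ℝ) ^ (j + 1) ≤ D * (1 / 16) ^ j := by
          rw [pow_succ]
          have : 0 ≤ D * (1 / 16 : ℝ) ^ j := by positivity
          nlinarith
        linarith
      calc 3 / ((1 / 2 : ℝ) ^ j) ^ 2 * ‖v‖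
          ≤ 3 / ((1 / 2 : ℝ) ^ j) ^ 2 * (2 * (D * (1 / 16) ^ j)) := by gcongr
        _ = 6 * D * (1 / 4) ^ j := by
          rw [← pow_mul, mul_comm j 2, pow_mul,
            show (1 / 16 : ℝ) = 1 / 4 * (1 / 4) by norm_num, mul_pow,
            show ((1 / 2 : ℝ)) ^ 2 = 1 / 4 by norm_num]
          field_simp
          ring
  choose next hnext1 hnext2 using hstep
  let s : ∀ j, State j := fun j => Nat.rec ⟨(x, B), hB, by simpa using hxy⟩ next j
  refine ⟨fun j => (s j).1.1, fun j => (s j).1.2, rfl, ?_, fun j => (s j).2.1,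
    fun j => hnext1 j (s j), fun j => hnext2 j (s j)⟩
  rw [tendsto_iff_norm_sub_tendsto_zero]
  refine squeeze_zero (fun _ => norm_nonneg _) (fun j => (s j).2.2) ?_
  simpa using (tendsto_pow_atTop_nhds_zero_of_lt_one (r := (1 / 16 : ℝ)) (by norm_num)
    (by norm_num)).const_mul D

/-- On the probability space of a Brownian motion `B` from `x` there is one from any `y` which
approaches `B` almost surely. -/
theorem IsBrownianFrom.exists_asymptotic_coupling [IsProbabilityMeasure P]
    (hμ : IsCenteredNondegGaussian μ) {x : W} {B : ℝ≥0 → Ω → W} (hB : IsBrownianFrom μ x B P)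
    (y : W) :
    ∃ B' : ℝ≥0 → Ω → W, IsBrownianFrom μ y B' P ∧
      ∀ᵐ ω ∂P, Tendsto (fun t => ‖B t ω - B' t ω‖) atTop (𝓝 0) := by
  set D := ‖x - y‖ + 1 with hD
  have hD0 : 0 < D := by positivity
  obtain ⟨z, C, hC0, hz, hC, hmeet, hbad⟩ := hB.exists_coupling_sequence hμ y hD0
    (by rw [hD]; linarith)
  have hsum : ∑' j, P {ω | ∃ t, 6 * D * (1 / 4) ^ j < ‖C j t ω - C (j + 1) t ω‖} ≠ ⊤ := by
    have hs : Summable fun j : ℕ => 2 * (1 / 2 : ℝ) ^ j :=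
      (summable_geometric_of_lt_one (by norm_num) (by norm_num)).mul_left _
    exact ne_top_of_le_ne_top hs.tsum_ofReal_ne_top (ENNReal.tsum_le_tsum hbad)
  have hsup : ∀ᵐ ω ∂P, ∀ᶠ j in atTop, ∀ t,
      ‖C j t ω - C (j + 1) t ω‖ ≤ 6 * D * (1 / 4) ^ j := by
    filter_upwards [ae_eventually_notMem hsum] with ω hω
    filter_upwards [hω] with j hj t
    exact not_lt.1 fun hlt => hj ⟨t, hlt⟩
  obtain ⟨B', hm, h0, hc, hlim⟩ := exists_continuous_limit (P := P) y (C := C)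
    (fun j t => (hC j).measurable t) (by
      filter_upwards [hsup] with ω hω
      obtain ⟨p, hp⟩ := exists_tendsto_of_geometric (b := fun j t => C j t ω) hω
      refine ⟨p, ?_, ?_, hp⟩
      · refine tendsto_nhds_unique (hp 0) ?_
        simpa only [(hC _).start] using hz
      · exact (tendstoUniformly_of_geometric hω hp).continuous
          (Eventually.of_forall fun j => (hC j).continuous_paths ω).frequently)
  refine ⟨B', ⟨hm, h0, hc, HasBrownianIncrements.of_tendsto (fun j t => (hC j).measurable t)
    (fun j => (hC j).increments) fun t => hlim.mono fun ω h => h t⟩, ?_⟩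
  filter_upwards [hsup, hlim, ae_all_iff.2 hmeet] with ω h1 h2 h3
  have hunif := Metric.tendstoUniformly_iff.1
    (tendstoUniformly_of_geometric (b := fun j t => C j t ω) h1 h2)
  -- each `C j` eventually coincides with `B`
  have h4 : ∀ j, ∀ᶠ t in atTop, C j t ω = B t ω := by
    intro j
    induction j with
    | zero => simp [hC0]
    | succ j ih =>
      filter_upwards [ih, h3 j] with t ht1 ht2
      rw [ht2, ht1]
  rw [Metric.tendsto_nhds]
  intro ε hε
  obtain ⟨j, hj⟩ := (hunif ε hε).exists
  filter_upwards [h4 j] with t ht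
  have := hj t
  rw [ht, dist_comm, dist_eq_norm] at this
  simpa using this

end Iteration

theorem theorem4p1 {W : Type u} [NormedAddCommGroup W] [NormedSpace ℝ W] [CompleteSpace W]
    [TopologicalSpace.SeparableSpace W] [MeasurableSpace W] [BorelSpace W]
    (μ : Measure W) (hμ : IsCenteredNondegGaussian μ)
    (e : ℕ → W) (he : IsSchauderBasisSeq e) (heμ : IsCameronMartinBasis μ e)
    (x y : W) :
    ∃ (Ω : Type u) (_ : MeasurableSpace Ω) (P : Measure Ω) (B B' : ℝ≥0 → Ω → W),
      IsProbabilityMeasure P ∧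
      IsBanachBrownianMotion μ x B P ∧
      IsBanachBrownianMotion μ y B' P ∧
      ∀ᵐ ω ∂P, Tendsto (fun t : ℝ≥0 => ‖B t ω - B' t ω‖) atTop (𝓝 0) := by
  have := UniformSpace.secondCountable_of_separable W
  obtain ⟨Ω, _, P, B, hP, hB⟩ := exists_isBrownianFrom hμ x
  obtain ⟨B', hB', hlim⟩ := hB.exists_asymptotic_coupling hμ y
  exact ⟨Ω, _, P, B, B', hP, hB.isBanachBrownianMotion hμ, hB'.isBanachBrownianMotion hμ, hlim⟩
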